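/- Let $A$ be a commutative algebra of functions of the times $t_1=x,t_2,t_3,\dots$ over $\mathbb Q$ (a Hausdorff topological ring with commuting continuous derivations $\partial/\partial t_l$, containing the coordinates $t_l$, in which all series $\sum_l t_l a_l$ converge; e.g. formal power series in the times, or smooth functions of sequences of times with finitely many non-zero terms). Pseudo-differential operators $P=\sum_{i\le N}p_iD^i$ over $A$ are multiplied by the Leibniz rule $D^n f=\sum_{j\ge0}\binom nj(\partial_x^jf)D^{n-j}$; $P_+$ and $P_-$ denote the parts with $i\ge0$ and $i<0$; $P_+(f)$ is the action on a function, $*$ is the formal adjoint. Let $r\ge1$, and let $L=WD^rW^{-1}$, $W=1+\sum_{n\ge1}w_nD^{-n}$, $L^{l/r}=WD^lW^{-1}$, be a ${\sf cKP}_{r,1}$ Lax operator: $\partial W/\partial t_l=-(L^{l/r})_-W$ for all $l\ge1$, and $L=L_++\Phi D^{-1}\Psi$, where $\partial\Phi/\partial t_l=(L^{l/r})_+(\Phi)$, $\partial\Psi/\partial t_l=-\big((L^{l/r})_+\big)^*(\Psi)$, and $\Phi$ is invertible. Let $M=W\big(\sum_{l\ge1}\frac lr t_lD^{l-r}\big)W^{-1}$.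 Write $L(f)=L_+(f)+\Phi\,\partial_x^{-1}(\Psi f)$ and $L^*(g)=(L_+)^*(g)-\Psi\,\partial_x^{-1}(\Phi g)$; the constants of integration used in $L^i(\Phi)$, $(L^*)^j(\Psi)$ are free, except that they are chosen consistently with integration by parts: $$\partial_x^{-1}\big(g\,L(f)\big)-\partial_x^{-1}\big(L^*(g)\,f\big)=B_{L_+}(f,g)+\partial_x^{-1}(\Psi f)\,\partial_x^{-1}(\Phi g)\qquad\text{for } f=L^i(\Phi),\ g=(L^*)^j(\Psi),$$ where $B_{L_+}$ is the bilinear concomitant of $L_+$, $\partial_xB_{L_+}(f,g)=g\,L_+(f)-(L_+)^*(g)\,f$. For $k\ge0$ put $$Y_k=\sum_{j=0}^{k-2}\Big(j-\tfrac{k-2}2\Big)L^{k-2-j}(\Phi)\,D^{-1}\,(L^*)^j(\Psi)\qquad(Y_0=Y_1=0),$$ and let the modified additional-symmetry flow $\partial^*_k$ be the vector field $$\partial^*_kL=\big[-(ML^k)_-+Y_k,\,L\big],\qquad \partial^*_k\Phi=(ML^k)_+(\Phi)+\tfrac k2L^{k-1}(\Phi)+Y_k(\Phi),$$ where the term $\frac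 k2L^{k-1}(\Phi)$ is $0$ for $k=0$, and $Y_k(\Phi)=\sum_{j=0}^{k-2}\big(j-\tfrac{k-2}2\big)L^{k-2-j}(\Phi)\,\partial_x^{-1}\big((L^*)^j(\Psi)\,\Phi\big)$. Let $T=\Phi D\Phi^{-1}$ and consider the Darboux–Bäcklund transforms $\tilde L=TLT^{-1}$, $\tilde W=TWD^{-1}$, $\tilde M=TMT^{-1}$, $\tilde\Phi=T(L(\Phi))$, $\tilde\Psi=\Phi^{-1}$. Then $\tilde L=\tilde WD^r\tilde W^{-1}$ is again a ${\sf cKP}_{r,1}$ Lax operator, with $\tilde L_-=\tilde\Phi D^{-1}\tilde\Psi$ (and with (adjoint) eigenfunctions $\tilde\Phi,\tilde\Psi$), the series over $l$ that define $(ML^k)_-$, $(ML^k)_+(\Phi)$ and $(\tilde M\tilde L^k)_-$ converge, and, with $\tilde Y_k$ formed from $\tilde L,\tilde\Phi,\tilde\Psi$ as $Y_k$ is from $L,\Phi,\Psi$ — with the antiderivatives $\partial_x^{-1}\big(\tilde\Psi\,\tilde L^i(\tilde\Phi)\big)=\Phi^{-1}L^{i+1}(\Phi)$, $i\ge0$,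 which together with integration by parts determine all others and are an admissible choice — the variation of $\tilde L$ induced by $\partial^*_k$ acting on $L$ and $\Phi$ is, for every $k\ge0$, $$\partial^*_k\tilde L=-\big[(\tilde M\tilde L^k)_--\tilde Y_k,\ \tilde L\big]+\frac{\partial\tilde L}{\partial t_{r(k-1)}},$$ where the last term is the isospectral flow $\big[(\tilde L^{k-1})_+,\tilde L\big]$ for $k\ge2$, and is $0$ for $k=0$ and $k=1$. That is, the flows $\partial^*_k$ commute with the Darboux–Bäcklund transformation up to a shift by an isospectral flow. -/

import Mathlib

/-!
Formal pseudo-differential operators over a commutative ring `A` with a derivation `d`.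
-/

/-- A formal pseudo-differential operator `∑_{i ≤ N} aᵢ Dⁱ` with coefficients in `A` (standing to
the left of the powers of `D`), where `D` acts on `A` through the derivation `d`. -/
@[ext]
structure PDO {A : Type*} [CommRing A] (d : Derivation ℤ A A) where
  coeff : ℤ → A
  bdd : ∃ N : ℤ, ∀ i, N < i → coeff i = 0

namespace PDO

variable {A : Type*} [CommRing A] {d : Derivation ℤ A A}

instance : Zero (PDO d) := ⟨⟨fun _ => 0, 0, fun _ _ => rfl⟩⟩

instance : One (PDO d) :=
  ⟨⟨fun i => if i = 0 then 1 else 0, 0, fun _ hi => if_neg hi.ne'⟩⟩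

instance : Add (PDO d) :=
  ⟨fun P Q => ⟨fun i => P.coeff i + Q.coeff i, by
    obtain ⟨M, hM⟩ := P.bdd
    obtain ⟨N, hN⟩ := Q.bdd
    exact ⟨max M N, fun i hi => by
      rw [hM i (lt_of_le_of_lt (le_max_left _ _) hi), hN i (lt_of_le_of_lt (le_max_right _ _) hi),
        add_zero]⟩⟩⟩

instance : Neg (PDO d) :=
  ⟨fun P => ⟨fun i => -P.coeff i, by
    obtain ⟨M, hM⟩ := P.bdd
    exact ⟨M, fun i hi => by rw [hM i hi, neg_zero]⟩⟩⟩

/-- The product determined by the generalized Leibniz rule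
`Dⁱ b = ∑_{m ≥ 0} (i choose m) (dᵐ b) Dⁱ⁻ᵐ`: the coefficient of `Dⁿ` in `P Q` is the (finite) sum
of `(i choose m) Pᵢ dᵐ(Qⱼ)` over all `i, j, m` with `i + j - m = n`. -/
noncomputable instance : Mul (PDO d) :=
  ⟨fun P Q => ⟨fun n => ∑ᶠ p : ℤ × ℕ,
      Ring.choose p.1 p.2 • (P.coeff p.1 * d^[p.2] (Q.coeff (n - p.1 + p.2))), by
    obtain ⟨M, hM⟩ := P.bdd
    obtain ⟨N, hN⟩ := Q.bdd
    refine ⟨M + N, fun n hn => ?_⟩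
    rw [← finsum_zero (α := ℤ × ℕ)]
    refine finsum_congr fun p => ?_
    rcases lt_or_ge M p.1 with h | h
    · rw [hM _ h, zero_mul, smul_zero]
    · rw [hN _ (by omega), iterate_map_zero, mul_zero, smul_zero]⟩⟩

@[simp] theorem coeff_zero (i : ℤ) : (0 : PDO d).coeff i = 0 := rfl

theorem coeff_one (i : ℤ) : (1 : PDO d).coeff i = if i = 0 then 1 else 0 := rfl

@[simp] theorem coeff_add (P Q : PDO d) (i : ℤ) : (P + Q).coeff i = P.coeff i + Q.coeff i := rfl

@[simp] theorem coeff_neg (P : PDO d) (i : ℤ) : (-P).coeff i = -P.coeff i := rfl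

theorem coeff_mul (P Q : PDO d) (n : ℤ) : (P * Q).coeff n = ∑ᶠ p : ℤ × ℕ,
    Ring.choose p.1 p.2 • (P.coeff p.1 * d^[p.2] (Q.coeff (n - p.1 + p.2))) := rfl

/-- The product as a sum over a finite set of indices. -/
theorem coeff_mul_eq (P Q : PDO d) (M N : ℤ) (hM : ∀ i, M < i → P.coeff i = 0)
    (hN : ∀ i, N < i → Q.coeff i = 0) (k : ℕ) :
    (P * Q).coeff (M + N - k) = ∑ p ∈ Finset.HasAntidiagonal.antidiagonal k, ∑ q ∈ Finset.HasAntidiagonal.antidiagonal p.2,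
      Ring.choose (M - p.1) q.1 • (P.coeff (M - p.1) * d^[q.1] (Q.coeff (N - q.2))) := by
  classical
  rw [coeff_mul, Finset.sum_sigma']
  set S : Finset (Σ _ : ℕ × ℕ, ℕ × ℕ) :=
    (Finset.HasAntidiagonal.antidiagonal k).sigma fun p => Finset.HasAntidiagonal.antidiagonal p.2 with hS
  let g : (Σ _ : ℕ × ℕ, ℕ × ℕ) → ℤ × ℕ := fun s => (M - s.1.1, s.2.1)
  have hg : Set.InjOn g S := by
    rintro ⟨⟨a, b⟩, ⟨c, e⟩⟩ h1 ⟨⟨a', b'⟩, ⟨c', e'⟩⟩ h2 h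
    simp only [hS, Finset.coe_sigma, Set.mem_sigma_iff, Finset.mem_coe,
      Finset.HasAntidiagonal.mem_antidiagonal] at h1 h2
    simp only [g, Prod.mk.injEq] at h
    obtain ⟨h3, h4⟩ := h
    obtain rfl : a = a' := by omega
    obtain rfl : c = c' := h4
    obtain rfl : b = b' := by omega
    obtain rfl : e = e' := by omega
    rfl
  rw [finsum_eq_sum_of_support_subset (s := S.image g), Finset.sum_image hg]
  · refine Finset.sum_congr rfl ?_
    rintro ⟨⟨a, b⟩, ⟨c, e⟩⟩ h1
    simp only [hS, Finset.mem_sigma, Finset.HasAntidiagonal.mem_antidiagonal] at h1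
    have : M + N - (k : ℤ) - (M - a) + c = N - e := by omega
    simp only [g, this]
  · rintro ⟨i, m⟩ h
    simp only [Function.mem_support] at h
    have h1 : i ≤ M := by
      by_contra hc
      exact h (by rw [hM _ (by omega), zero_mul, smul_zero])
    have h2 : M + N - (k : ℤ) - i + m ≤ N := by
      by_contra hc
      exact h (by rw [hN _ (by omega), iterate_map_zero, mul_zero, smul_zero])
    simp only [Finset.coe_image, Set.mem_image, Finset.mem_coe, hS, Finset.mem_sigma,
      Finset.HasAntidiagonal.mem_antidiagonal, g]
    refine ⟨⟨⟨(M - i).toNat, k - (M - i).toNat⟩, ⟨m, k - (M - i).toNat - m⟩⟩, ⟨?_, ?_⟩, ?_⟩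
    · simp only; omega
    · simp only; omega
    · simp only [Prod.mk.injEq, and_true]; omega

theorem exists_bound (P : PDO d) (K : ℤ) : ∃ N, K ≤ N ∧ ∀ i, N < i → P.coeff i = 0 := by
  obtain ⟨N, hN⟩ := P.bdd
  exact ⟨max K N, le_max_left _ _, fun i hi => hN i (lt_of_le_of_lt (le_max_right _ _) hi)⟩

theorem iterate_leibniz (d : Derivation ℤ A A) (p : ℕ) (a b : A) :
    d^[p] (a * b) = ∑ q ∈ Finset.HasAntidiagonal.antidiagonal p, p.choose q.1 • (d^[q.1] a * d^[q.2] b) := by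
  induction p with
  | zero => simp
  | succ p ih =>
    rw [Function.iterate_succ_apply', ih, map_sum,
      Finset.sum_antidiagonal_choose_succ_nsmul fun i j => d^[i] a * d^[j] b,
      ← Finset.sum_add_distrib]
    refine Finset.sum_congr rfl fun q hq => ?_
    have h : p.choose q.1 = p.choose q.2 :=
      (Nat.choose_symm_of_eq_add (Finset.HasAntidiagonal.mem_antidiagonal.mp hq).symm)
    rw [map_nsmul, Derivation.leibniz, ← h, ← smul_add, Function.iterate_succ_apply',
      Function.iterate_succ_apply', smul_eq_mul, smul_eq_mul]
    congr 1
    ring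

theorem iterate_sum {ι : Type*} (d : Derivation ℤ A A) (p : ℕ) (s : Finset ι) (f : ι → A) :
    d^[p] (∑ i ∈ s, f i) = ∑ i ∈ s, d^[p] (f i) := by
  induction p with
  | zero => rfl
  | succ p ih => simp only [Function.iterate_succ_apply', ih, map_sum]

theorem iterate_zsmul (d : Derivation ℤ A A) (p : ℕ) (z : ℤ) (a : A) :
    d^[p] (z • a) = z • d^[p] a := by
  induction p with
  | zero => rfl
  | succ p ih => simp only [Function.iterate_succ_apply', ih, map_zsmul]

theorem iterate_add' (d : Derivation ℤ A A) (p : ℕ) (a b : A) :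
    d^[p] (a + b) = d^[p] a + d^[p] b := by
  induction p with
  | zero => rfl
  | succ p ih => simp only [Function.iterate_succ_apply', ih, map_add]

theorem bound_mul {P Q : PDO d} {M N : ℤ} (hM : ∀ i, M < i → P.coeff i = 0)
    (hN : ∀ i, N < i → Q.coeff i = 0) : ∀ i, M + N < i → (P * Q).coeff i = 0 := by
  intro n hn
  rw [coeff_mul, ← finsum_zero (α := ℤ × ℕ)]
  refine finsum_congr fun p => ?_
  rcases lt_or_ge M p.1 with h | h
  · rw [hM _ h, zero_mul, smul_zero]
  · rw [hN _ (by omega), iterate_map_zero, mul_zero, smul_zero]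

theorem sum_rearrange (k : ℕ) (F : ℕ → ℕ → ℕ → ℕ → ℕ → ℕ → A) :
    ∑ w ∈ Finset.HasAntidiagonal.antidiagonal k, ∑ z ∈ Finset.HasAntidiagonal.antidiagonal w.2,
      ∑ x ∈ Finset.HasAntidiagonal.antidiagonal w.1, ∑ y ∈ Finset.HasAntidiagonal.antidiagonal x.2,
      ∑ u ∈ Finset.HasAntidiagonal.antidiagonal z.1, F x.1 y.1 y.2 u.1 u.2 z.2 =
    ∑ x ∈ Finset.HasAntidiagonal.antidiagonal k, ∑ p ∈ Finset.HasAntidiagonal.antidiagonal x.2,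
      ∑ y ∈ Finset.HasAntidiagonal.antidiagonal p.2, ∑ q ∈ Finset.HasAntidiagonal.antidiagonal y.2,
      ∑ s ∈ Finset.HasAntidiagonal.antidiagonal p.1, F x.1 s.1 y.1 s.2 q.1 q.2 := by
  simp only [Finset.sum_sigma']
  refine Finset.sum_nbij'
    (fun t => ⟨(t.2.2.1.1, t.2.2.2.1.1 + t.2.1.1 + t.2.2.2.1.2 + t.2.1.2),
      ⟨(t.2.2.2.1.1 + t.2.2.2.2.1, t.2.2.2.1.2 + t.2.2.2.2.2 + t.2.1.2),
      ⟨(t.2.2.2.1.2, t.2.2.2.2.2 + t.2.1.2), ⟨(t.2.2.2.2.2, t.2.1.2),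
        (t.2.2.2.1.1, t.2.2.2.2.1)⟩⟩⟩⟩)
    (fun t => ⟨(t.1.1 + t.2.2.2.2.1 + t.2.2.1.1, t.2.2.2.2.2 + t.2.2.2.1.1 + t.2.2.2.1.2),
      ⟨(t.2.2.2.2.2 + t.2.2.2.1.1, t.2.2.2.1.2), ⟨(t.1.1, t.2.2.2.2.1 + t.2.2.1.1),
      ⟨(t.2.2.2.2.1, t.2.2.1.1), (t.2.2.2.2.2, t.2.2.2.1.1)⟩⟩⟩⟩) ?_ ?_ ?_ ?_ ?_
  · rintro ⟨⟨a, b⟩, ⟨c, e⟩, ⟨f, g⟩, ⟨h, i⟩, ⟨j, l⟩⟩ ht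
    simp only [Finset.mem_sigma, Finset.HasAntidiagonal.mem_antidiagonal] at ht ⊢
    refine ⟨?_, ?_, ?_, ?_, ?_⟩ <;> first | omega | trivial
  · rintro ⟨⟨a, b⟩, ⟨c, e⟩, ⟨f, g⟩, ⟨h, i⟩, ⟨j, l⟩⟩ ht
    simp only [Finset.mem_sigma, Finset.HasAntidiagonal.mem_antidiagonal] at ht ⊢
    refine ⟨?_, ?_, ?_, ?_, ?_⟩ <;> first | omega | trivial
  · rintro ⟨⟨a, b⟩, ⟨c, e⟩, ⟨f, g⟩, ⟨h, i⟩, ⟨j, l⟩⟩ ht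
    simp only [Finset.mem_sigma, Finset.HasAntidiagonal.mem_antidiagonal] at ht
    obtain ⟨h1, h2, h3, h4, h5⟩ := ht
    simp only [Sigma.mk.injEq, Prod.mk.injEq, heq_eq_eq, and_true, true_and]
    omega
  · rintro ⟨⟨a, b⟩, ⟨c, e⟩, ⟨f, g⟩, ⟨h, i⟩, ⟨j, l⟩⟩ ht
    simp only [Finset.mem_sigma, Finset.HasAntidiagonal.mem_antidiagonal] at ht
    obtain ⟨h1, h2, h3, h4, h5⟩ := ht
    simp only [Sigma.mk.injEq, Prod.mk.injEq, heq_eq_eq, and_true, true_and]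
    omega
  · rintro ⟨⟨a, b⟩, ⟨c, e⟩, ⟨f, g⟩, ⟨h, i⟩, ⟨j, l⟩⟩ ht
    rfl

protected theorem mul_assoc (P Q R : PDO d) : P * Q * R = P * (Q * R) := by
  ext n
  obtain ⟨K, hnK, hK⟩ := P.exists_bound n
  obtain ⟨M, h0M, hM⟩ := Q.exists_bound 0
  obtain ⟨N, h0N, hN⟩ := R.exists_bound 0
  obtain ⟨k, hk⟩ : ∃ k : ℕ, n = K + M + N - k := ⟨(K + M + N - n).toNat, by omega⟩
  have e1 : (P * Q * R).coeff n = ∑ w ∈ Finset.HasAntidiagonal.antidiagonal k,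
      ∑ z ∈ Finset.HasAntidiagonal.antidiagonal w.2, ∑ x ∈ Finset.HasAntidiagonal.antidiagonal w.1,
      ∑ y ∈ Finset.HasAntidiagonal.antidiagonal x.2, ∑ u ∈ Finset.HasAntidiagonal.antidiagonal z.1,
        (Ring.choose (K - x.1) y.1 * (Ring.choose (K - x.1 - y.1) u.1 * Ring.choose (M - y.2) u.2))
          • (P.coeff (K - x.1) * d^[y.1] (Q.coeff (M - y.2)) * d^[z.1] (R.coeff (N - z.2))) := by
    rw [hk, coeff_mul_eq _ _ (K + M) N (bound_mul hK hM) hN]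
    refine Finset.sum_congr rfl fun w _ => Finset.sum_congr rfl fun z _ => ?_
    rw [coeff_mul_eq _ _ K M hK hM, Finset.sum_mul, Finset.smul_sum]
    refine Finset.sum_congr rfl fun x hx => ?_
    rw [Finset.sum_mul, Finset.smul_sum]
    refine Finset.sum_congr rfl fun y hy => ?_
    rw [← Finset.sum_smul, ← Finset.mul_sum, ← Ring.add_choose_eq _ (Commute.all _ _),
      smul_mul_assoc, smul_smul, mul_comm]
    simp only [Finset.HasAntidiagonal.mem_antidiagonal] at hx hy
    congr 3
    omega
  have e2 : (P * (Q * R)).coeff n = ∑ x ∈ Finset.HasAntidiagonal.antidiagonal k,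
      ∑ p ∈ Finset.HasAntidiagonal.antidiagonal x.2, ∑ y ∈ Finset.HasAntidiagonal.antidiagonal p.2,
      ∑ q ∈ Finset.HasAntidiagonal.antidiagonal y.2, ∑ s ∈ Finset.HasAntidiagonal.antidiagonal p.1,
        (Ring.choose (K - x.1) s.1 * (Ring.choose (K - x.1 - s.1) s.2 * Ring.choose (M - y.1) q.1))
          • (P.coeff (K - x.1) * d^[s.1] (Q.coeff (M - y.1)) *
            d^[s.2 + q.1] (R.coeff (N - q.2))) := by
    rw [hk, show K + M + N - (k : ℤ) = K + (M + N) - k by ring,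
      coeff_mul_eq _ _ K (M + N) hK (bound_mul hM hN)]
    refine Finset.sum_congr rfl fun x _ => Finset.sum_congr rfl fun p _ => ?_
    rw [coeff_mul_eq _ _ M N hM hN, iterate_sum, Finset.mul_sum, Finset.smul_sum]
    refine Finset.sum_congr rfl fun y _ => ?_
    rw [iterate_sum, Finset.mul_sum, Finset.smul_sum]
    refine Finset.sum_congr rfl fun q _ => ?_
    rw [iterate_zsmul, iterate_leibniz, Finset.smul_sum, Finset.mul_sum, Finset.smul_sum]
    refine Finset.sum_congr rfl fun s hs => ?_
    have hs' := Finset.HasAntidiagonal.mem_antidiagonal.mp hs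
    have hc := Ring.choose_smul_choose (K - x.1 : ℤ) (n := p.1) (k := s.1) (by omega)
    rw [show p.1 - s.1 = s.2 by omega] at hc
    rw [← mul_assoc (Ring.choose (K - x.1 : ℤ) s.1), ← hc, ← Function.iterate_add_apply]
    simp only [zsmul_eq_mul, nsmul_eq_mul]
    push_cast
    ring
  rw [e1, e2, ← sum_rearrange k fun x m y u q z =>
    (Ring.choose (K - x : ℤ) m * (Ring.choose (K - x - m : ℤ) u * Ring.choose (M - y : ℤ) q))
      • (P.coeff (K - x) * d^[m] (Q.coeff (M - y)) * d^[u + q] (R.coeff (N - z)))]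
  refine Finset.sum_congr rfl fun w _ => Finset.sum_congr rfl fun z _ =>
    Finset.sum_congr rfl fun x _ => Finset.sum_congr rfl fun y _ =>
    Finset.sum_congr rfl fun u hu => ?_
  rw [Finset.HasAntidiagonal.mem_antidiagonal.mp hu]

theorem exists_common_bound (P Q : PDO d) :
    ∃ N, (∀ i, N < i → P.coeff i = 0) ∧ ∀ i, N < i → Q.coeff i = 0 := by
  obtain ⟨M, -, hM⟩ := P.exists_bound 0
  obtain ⟨N, hMN, hN⟩ := Q.exists_bound M
  exact ⟨N, fun i hi => hM i (by omega), hN⟩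

protected theorem mul_add (P Q R : PDO d) : P * (Q + R) = P * Q + P * R := by
  ext n
  obtain ⟨N, hQ, hR⟩ := exists_common_bound Q R
  obtain ⟨M, hnM, hM⟩ := P.exists_bound (n - N)
  obtain ⟨k, rfl⟩ : ∃ k : ℕ, n = M + N - k := ⟨(M + N - n).toNat, by omega⟩
  rw [coeff_add, coeff_mul_eq _ _ M N hM hQ, coeff_mul_eq _ _ M N hM hR,
    coeff_mul_eq _ _ M N hM (fun i hi => by rw [coeff_add, hQ i hi, hR i hi, add_zero])]
  simp only [coeff_add, iterate_add', _root_.mul_add, smul_add, Finset.sum_add_distrib]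

protected theorem add_mul (P Q R : PDO d) : (P + Q) * R = P * R + Q * R := by
  ext n
  obtain ⟨N, hP, hQ⟩ := exists_common_bound P Q
  obtain ⟨M, hnM, hM⟩ := R.exists_bound (n - N)
  obtain ⟨k, rfl⟩ : ∃ k : ℕ, n = N + M - k := ⟨(N + M - n).toNat, by omega⟩
  rw [coeff_add, coeff_mul_eq _ _ N M hP hM, coeff_mul_eq _ _ N M hQ hM,
    coeff_mul_eq _ _ N M (fun i hi => by rw [coeff_add, hP i hi, hQ i hi, add_zero]) hM]
  simp only [coeff_add, _root_.add_mul, smul_add, Finset.sum_add_distrib]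

/-- The operator of multiplication by `a` (a zero-order operator). -/
def mulOp (d : Derivation ℤ A A) (a : A) : PDO d :=
  ⟨fun i => if i = 0 then a else 0, 0, fun _ hi => if_neg hi.ne'⟩

/-- The power `Dⁿ`, for an integer `n`. -/
def powD (d : Derivation ℤ A A) (n : ℤ) : PDO d :=
  ⟨fun i => if i = n then 1 else 0, n, fun _ hi => if_neg hi.ne'⟩

theorem coeff_mulOp_mul (a : A) (P : PDO d) (n : ℤ) :
    (mulOp d a * P).coeff n = a * P.coeff n := by
  rw [coeff_mul, finsum_eq_single _ (0, 0)]
  · simp [mulOp]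
  · rintro ⟨i, m⟩ h
    by_cases hi : i = 0
    · subst hi
      have hm : m ≠ 0 := fun hm => h (by rw [hm])
      simp only [Ring.choose_zero_ite, if_neg hm, zero_smul]
    · simp only [mulOp, if_neg hi, zero_mul, smul_zero]

theorem iterate_one_or_zero (m : ℕ) (hm : m ≠ 0) (p : Prop) [Decidable p] :
    d^[m] (if p then (1 : A) else 0) = 0 := by
  obtain ⟨m, rfl⟩ := Nat.exists_eq_succ_of_ne_zero hm
  rw [Function.iterate_succ_apply]
  split_ifs
  · rw [Derivation.map_one_eq_zero, iterate_map_zero]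
  · rw [map_zero, iterate_map_zero]

theorem coeff_mul_powD (P : PDO d) (j n : ℤ) : (P * powD d j).coeff n = P.coeff (n - j) := by
  rw [coeff_mul, finsum_eq_single _ (n - j, 0)]
  · simp [powD]
  · rintro ⟨i, m⟩ h
    by_cases hm : m = 0
    · subst hm
      have hi : n - i + ((0 : ℕ) : ℤ) ≠ j := fun hi => h (by rw [← hi]; simp)
      simp only [powD, if_neg hi, iterate_map_zero, mul_zero, smul_zero]
    · simp only [powD, iterate_one_or_zero m hm, mul_zero, smul_zero]

theorem one_eq_mulOp : (1 : PDO d) = mulOp d 1 := rfl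

theorem one_eq_powD : (1 : PDO d) = powD d 0 := rfl

noncomputable instance : Ring (PDO d) where
  add_assoc P Q R := by ext i; exact add_assoc _ _ _
  zero_add P := by ext i; exact zero_add _
  add_zero P := by ext i; exact add_zero _
  add_comm P Q := by ext i; exact add_comm _ _
  neg_add_cancel P := by ext i; exact neg_add_cancel _
  nsmul := nsmulRec
  zsmul := zsmulRec
  left_distrib := PDO.mul_add
  right_distrib := PDO.add_mul
  zero_mul P := by
    ext n
    rw [coeff_mul]
    simp
  mul_zero P := by
    ext n
    rw [coeff_mul]
    simp
  mul_assoc := PDO.mul_assoc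
  one_mul P := by ext n; rw [one_eq_mulOp, coeff_mulOp_mul, one_mul]
  mul_one P := by ext n; rw [one_eq_powD, coeff_mul_powD, sub_zero]

/-- The embedding of functions as zero-order operators. -/
noncomputable def C (d : Derivation ℤ A A) : A →+* PDO d where
  toFun := mulOp d
  map_one' := rfl
  map_mul' a b := by
    ext n
    rw [coeff_mulOp_mul]
    simp [mulOp]
  map_zero' := by ext n; simp [mulOp]
  map_add' a b := by
    ext n
    rw [coeff_add]
    simp only [mulOp]
    split_ifs <;> simp

/-- The operator `D`, with its inverse `D⁻¹`. -/
noncomputable def D (d : Derivation ℤ A A) : (PDO d)ˣ where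
  val := powD d 1
  inv := powD d (-1)
  val_inv := by
    ext n
    rw [coeff_mul_powD, coeff_one]
    simp only [powD]
    congr 1
    simp
  inv_val := by
    ext n
    rw [coeff_mul_powD, coeff_one]
    simp only [powD]
    congr 1
    rw [sub_eq_neg_self]

/-- The purely differential part `P₊` of `P`. -/
def pos (P : PDO d) : PDO d :=
  ⟨fun i => if 0 ≤ i then P.coeff i else 0, by
    obtain ⟨N, hN⟩ := P.bdd
    exact ⟨N, fun i hi => by rw [hN i hi, ite_self]⟩⟩

/-- The purely pseudo-differential part `P₋` of `P`. -/
def neg (P : PDO d) : PDO d :=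
  ⟨fun i => if i < 0 then P.coeff i else 0, by
    obtain ⟨N, hN⟩ := P.bdd
    exact ⟨N, fun i hi => by rw [hN i hi, ite_self]⟩⟩

/-- The action `P₊(f)` of the differential part of `P` on a function. -/
noncomputable def posApply (P : PDO d) (f : A) : A :=
  ∑ᶠ n : ℕ, P.coeff n * d^[n] f

/-- The action `(P₊)*(g)` of the formal adjoint of the differential part of `P` on a function,
where `(a Dⁿ)* = (-D)ⁿ a`. -/
noncomputable def posAdjApply (P : PDO d) (g : A) : A :=
  ∑ᶠ n : ℕ, (-1) ^ n * d^[n] (P.coeff n * g)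

/-- The bilinear concomitant of `P₊`, the bilinear differential expression with
`d (concomitant P f g) = g * P₊(f) - (P₊)*(g) * f` (Lagrange's identity). -/
noncomputable def concomitant (P : PDO d) (f g : A) : A :=
  ∑ᶠ n : ℕ, ∑ k ∈ Finset.range n, (-1) ^ k * d^[k] (P.coeff n * g) * d^[n - 1 - k] f

/-- A derivation applied to all coefficients, e.g. a time derivative of an operator. -/
def mapCoeff (δ : Derivation ℤ A A) (P : PDO d) : PDO d :=
  ⟨fun i => δ (P.coeff i), by
    obtain ⟨N, hN⟩ := P.bdd
    exact ⟨N, fun i hi => by rw [hN i hi, map_zero]⟩⟩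

/-- The commutator `[P, Q]`. -/
noncomputable def comm (P Q : PDO d) : PDO d := P * Q - Q * P

end PDO

namespace CKP

open PDO

variable {A : Type*} [CommRing A]

variable {d : Derivation ℤ A A}

/-! ### First-order variations, through dual numbers `a + ε b` with `ε² = 0` -/

/-- The dual number `a + ε b`. -/
def dual (a b : A) : DualNumber A := TrivSqZeroExt.inl a + TrivSqZeroExt.inr b

@[simp] theorem fst_dual (a b : A) : (dual a b).fst = a := by simp [dual]

@[simp] theorem snd_dual (a b : A) : (dual a b).snd = b := by simp [dual]

/-- The derivation of `A[ε]` that extends `d` with `d ε = 0`. -/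
def dualDer (d : Derivation ℤ A A) : Derivation ℤ (DualNumber A) (DualNumber A) :=
  Derivation.mk'
    { toFun := fun a => dual (d a.fst) (d a.snd)
      map_add' := fun a b => by ext <;> simp
      map_smul' := fun z a => by ext <;> simp }
    (fun a b => by
      ext
      · simp
      · simp
        ring)

/-- The operator `P + ε X` with coefficients in `A[ε]`. -/
def dualOp (P X : PDO d) : PDO (dualDer d) :=
  ⟨fun i => dual (P.coeff i) (X.coeff i), by
    obtain ⟨N, hP, hX⟩ := exists_common_bound P X
    exact ⟨N, fun i hi => by rw [hP i hi, hX i hi]; ext <;> simp⟩⟩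

/-- The coefficient of `ε` in an operator over `A[ε]`. -/
def epsPart (P : PDO (dualDer d)) : PDO d :=
  ⟨fun i => (P.coeff i).snd, by
    obtain ⟨N, hN⟩ := P.bdd
    exact ⟨N, fun i hi => by rw [hN i hi]; rfl⟩⟩

/-- The invertible function `Φ + ε φ`. -/
def dualUnit (Φ : Aˣ) (φ : A) : (DualNumber A)ˣ where
  val := dual Φ φ
  inv := dual ↑Φ⁻¹ (-(↑Φ⁻¹ * ↑Φ⁻¹ * φ))
  val_inv := by
    ext
    · simp
    · simp [← mul_assoc]
      rw [mul_comm, neg_add_cancel]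
  inv_val := by
    ext
    · simp
    · simp
      rw [mul_right_comm, mul_assoc (↑Φ⁻¹ : A), Units.inv_mul, mul_one, mul_comm]
      simp

/-! ### The hierarchy -/

/-- The algebra of functions of the times `t₁ = x, t₂, t₃, …`: the `dt l = ∂/∂tₗ` are commuting
continuous derivations, the `t l` are the coordinate functions, and every series
`∑ₗ tₗ aₗ` converges. Examples are formal power series in the times, or smooth functions of
sequences of times of which only finitely many are non-zero. -/
structure IsTimeSystem [TopologicalSpace A] (dt : ℕ+ → Derivation ℤ A A) (t : ℕ+ → A) : Prop where
  continuous : ∀ l, Continuous (dt l)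
  commute : ∀ l m a, dt l (dt m a) = dt m (dt l a)
  dt_t : ∀ l m, dt l (t m) = if l = m then 1 else 0
  summable : ∀ a : ℕ+ → A, Summable fun l => t l * a l

/-- The Lax operator `L = W Dʳ W⁻¹` and, more generally, its fractional powers
`L^{l/r} = W Dˡ W⁻¹ = dressed W l`. -/
noncomputable def dressed (W : (PDO d)ˣ) (l : ℕ) : PDO d :=
  W * (D d : PDO d) ^ l * (W⁻¹ : (PDO d)ˣ)

/-- `W = 1 + ∑_{n ≥ 1} wₙ D⁻ⁿ` is the dressing operator of a solution `L = W Dʳ W⁻¹` of the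
constrained KP hierarchy `cKP_{r,1}`, that is, `W` solves the Wilson-Sato equations and
`L = L₊ + Φ D⁻¹ Ψ` with an eigenfunction `Φ` and an adjoint eigenfunction `Ψ`. -/
structure IsCKP (dt : ℕ+ → Derivation ℤ A A) (r : ℕ) (W : (PDO (dt 1))ˣ) (Φ Ψ : A) : Prop where
  coeff_zero : (W : PDO (dt 1)).coeff 0 = 1
  coeff_pos : ∀ i > 0, (W : PDO (dt 1)).coeff i = 0
  sato : ∀ l : ℕ+, mapCoeff (dt l) (W : PDO (dt 1)) = -(dressed W l).neg * W
  constraint : (dressed W r).neg = C (dt 1) Φ * ((D (dt 1))⁻¹ : (PDO (dt 1))ˣ) * C (dt 1) Ψ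
  eigenfunction : ∀ l : ℕ+, dt l Φ = (dressed W l).posApply Φ
  adjoint_eigenfunction : ∀ l : ℕ+, dt l Ψ = -(dressed W l).posAdjApply Ψ

/-- For `L = L₊ + Φ D⁻¹ Ψ`, the functions `Lⁱ(Φ)` and `(L*)ʲ(Ψ)`, where
`L(f) = L₊(f) + Φ ∂ₓ⁻¹(Ψ f)` and `L*(g) = (L₊)*(g) - Ψ ∂ₓ⁻¹(Φ g)`, together with the
antiderivatives `S i j = ∂ₓ⁻¹(Lⁱ(Φ) (L*)ʲ(Ψ))` that are used.

The constants of integration are free, except that `∂ₓ⁻¹` obeys integration by parts,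
`∂ₓ⁻¹(g L(f)) - ∂ₓ⁻¹(L*(g) f) = concomitant of (L₊, f, g) + ∂ₓ⁻¹(Ψ f) ∂ₓ⁻¹(Φ g)`,
for `f = Lⁱ(Φ)`, `g = (L*)ʲ(Ψ)`. (Both sides always have the same `x`-derivative; after any choice
of the antiderivatives `S i 0`, this rule determines all others.) -/
structure NonlocalAction (L : PDO d) (Φ Ψ : A) where
  /-- `φ i = Lⁱ(Φ)` -/
  φ : ℕ → A
  /-- `ψ j = (L*)ʲ(Ψ)` -/
  ψ : ℕ → A
  /-- `S i j = ∂ₓ⁻¹(φ i * ψ j)` -/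
  S : ℕ → ℕ → A
  deriv_S : ∀ i j, d (S i j) = φ i * ψ j
  φ_zero : φ 0 = Φ
  φ_succ : ∀ i, φ (i + 1) = L.posApply (φ i) + Φ * S i 0
  ψ_zero : ψ 0 = Ψ
  ψ_succ : ∀ j, ψ (j + 1) = L.posAdjApply (ψ j) - Ψ * S 0 j
  by_parts : ∀ i j,
    S (i + 1) j - S i (j + 1) = L.concomitant (φ i) (ψ j) + S i 0 * S 0 j

/-! ### The modified additional-symmetry flows -/

section Flows

variable [Algebra ℚ A]

/-- The coefficient `j - (k - 2) / 2`. -/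
noncomputable def coeffY (A : Type*) [CommRing A] [Algebra ℚ A] (k j : ℕ) : A :=
  algebraMap ℚ A (j - (k - 2) / 2)

/-- `Yₖ = ∑_{j=0}^{k-2} (j - (k-2)/2) L^{k-2-j}(Φ) D⁻¹ (L*)ʲ(Ψ)`, an empty sum for `k = 0, 1`. -/
noncomputable def Y {L : PDO d} {Φ Ψ : A} (p : NonlocalAction L Φ Ψ) (k : ℕ) : PDO d :=
  ∑ j ∈ Finset.range (k - 1),
    C d (coeffY A k j * p.φ (k - 2 - j)) * ((D d)⁻¹ : (PDO d)ˣ) * C d (p.ψ j)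

/-- The function `Yₖ(Φ) = ∑_{j=0}^{k-2} (j - (k-2)/2) L^{k-2-j}(Φ) ∂ₓ⁻¹((L*)ʲ(Ψ) Φ)`. -/
noncomputable def applyY {L : PDO d} {Φ Ψ : A} (p : NonlocalAction L Φ Ψ) (k : ℕ) : A :=
  ∑ j ∈ Finset.range (k - 1), coeffY A k j * p.φ (k - 2 - j) * p.S 0 j

/-- The operator `M = W M⁽⁰⁾ W⁻¹`, `M⁽⁰⁾ = ∑_{l ≥ 1} (l/r) tₗ D^{l-r}`, whose order is in general
unbounded, is represented by the family of its summands `W (l/r) tₗ D^{l-r} W⁻¹`. -/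
noncomputable def M (t : ℕ+ → A) (r : ℕ) (W : (PDO d)ˣ) (l : ℕ+) : PDO d :=
  W * C d (algebraMap ℚ A ((l : ℚ) / r) * t l) * ((D d ^ ((l : ℤ) - r) : (PDO d)ˣ) : PDO d)
    * (W⁻¹ : (PDO d)ˣ)

variable [TopologicalSpace A]

/-- The pseudo-differential part `(∑ₗ Nₗ)₋` of a sum of operators, coefficient by coefficient. -/
noncomputable def negSum (N : ℕ+ → PDO d) : PDO d :=
  ⟨fun i => if i < 0 then ∑' l, (N l).coeff i else 0, 0, fun _ hi => if_neg hi.not_gt⟩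

/-- The function `(∑ₗ Nₗ)₊(f)`. -/
noncomputable def posSumApply (N : ℕ+ → PDO d) (f : A) : A :=
  ∑' l, (N l).posApply f

/-- The vector field `[-(M Lᵏ)₋ + Yₖ, L]` on Lax operators: this is `∂*ₖ L`. Here `M` is given by
the family of its summands. -/
noncomputable def flowL {L : PDO d} {Φ Ψ : A} (M : ℕ+ → PDO d) (p : NonlocalAction L Φ Ψ)
    (k : ℕ) : PDO d :=
  comm (-negSum (fun l => M l * L ^ k) + Y p k) L

/-- The flow `∂*ₖ Φ = (M Lᵏ)₊(Φ) + (k/2) L^{k-1}(Φ) + Yₖ(Φ)` of the eigenfunction; the middle term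
vanishes for `k = 0`. -/
noncomputable def flowΦ {L : PDO d} {Φ Ψ : A} (M : ℕ+ → PDO d) (p : NonlocalAction L Φ Ψ)
    (k : ℕ) : A :=
  posSumApply (fun l => M l * L ^ k) Φ + algebraMap ℚ A (k / 2) * p.φ (k - 1) + applyY p k

end Flows

/-! ### Darboux-Bäcklund transformations -/

/-- The Darboux-Bäcklund operator `T = Φ D Φ⁻¹`. -/
noncomputable def darboux (d : Derivation ℤ A A) (Φ : Aˣ) : (PDO d)ˣ :=
  Units.map (C d : A →* PDO d) Φ * D d * (Units.map (C d : A →* PDO d) Φ)⁻¹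

/-- The conjugate `T P T⁻¹`, `T = Φ D Φ⁻¹`. -/
noncomputable def conj (Φ : Aˣ) (P : PDO d) : PDO d :=
  darboux d Φ * P * ((darboux d Φ)⁻¹ : (PDO d)ˣ)

/-- The first-order variation of `L̃ = T L T⁻¹`, `T = Φ D Φ⁻¹`, when `L` moves with velocity `X` and
`Φ` with velocity `φ`: the coefficient of `ε` in `L̃` computed for `L + ε X` and `Φ + ε φ`. -/
noncomputable def conjVariation (Φ : Aˣ) (L : PDO d) (φ : A) (X : PDO d) : PDO d :=
  epsPart (conj (dualUnit Φ φ) (dualOp L X))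

/-- The derivative `∂P/∂tₙ` for `n ≥ 1`; there is no time `t₀`, and `∂P/∂t₀ = 0`, in accordance
with `[L⁰, L] = 0`. -/
noncomputable def timeDeriv (dt : ℕ+ → Derivation ℤ A A) (n : ℕ) (P : PDO d) : PDO d :=
  if h : 0 < n then mapCoeff (dt ⟨n, h⟩) P else 0

end CKP

/-! Put T = ΦDΦ⁻¹, so that T(Φ) = 0. The proof compares generators of Lax flows. If L moves by [B,
L] and Φ with velocity φ, then L̃ = TLT⁻¹ moves by the commutator of TBT⁻¹ + δT·T⁻¹ with L̃
(`conjVariation_eq`). Here δT is of order zero and δT·T⁻¹ = -T(φ) D⁻¹ Φ⁻¹ (`darbouxVar_mul_inv`).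

On the other hand, division by D from the right gives (TPT⁻¹)₋ = T P₋ T⁻¹ + T(P₊(Φ)) D⁻¹ Φ⁻¹
(`neg_conj`). So the summand (MLᵏ)₊(Φ) of the velocity of Φ supplies exactly what turns T(MLᵏ)₋T⁻¹
into (M̃L̃ᵏ)₋. `negSum_conj` extends this to the infinite sum M. The same cancellation for L^{l/r}
gives the Wilson-Sato equations of W̃ (`isCKP_darboux`).

There remains the identity `conj_Y_sub`: T Yₖ T⁻¹, corrected by the other summands of the velocity
of Φ, equals Ỹₖ - (L̃^{k-1})₋. Conjugation of f D⁻¹ ψ yields a term ending in D⁻¹ Φ⁻¹, which Yₖ(Φ)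
cancels, and a term with ψ replaced by -Φ⁻¹∂ₓ⁻¹(Φψ) (`conj_rank_one`). The latter raises the adjoint
index by one, because (L̃*)ʲ⁺¹(Ψ̃) = -Φ⁻¹∂ₓ⁻¹(Φ(L*)ʲ(Ψ)) (`NonlocalAction.darboux`). The
coefficients of Yₖ have step one, so the shift costs one copy of Σ L̃^{k-2-j}(Φ̃) D⁻¹ (L̃*)ʲ(Ψ̃),
which is (L̃^{k-1})₋ by `neg_pow_and_posApply_pow`. As L̃^{k-1} commutes with L̃, the generator
-(L̃^{k-1})₋ acts as (L̃^{k-1})₊: this is the isospectral shift. -/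

namespace PDO

variable {A : Type*} [CommRing A] {d : Derivation ℤ A A}

/-! ### Differential and purely pseudo-differential operators -/

theorem coeff_sub (P Q : PDO d) (i : ℤ) : (P - Q).coeff i = P.coeff i - Q.coeff i := by
  rw [sub_eq_add_neg, coeff_add, coeff_neg, ← sub_eq_add_neg]

theorem coeff_sum {ι : Type*} (s : Finset ι) (P : ι → PDO d) (i : ℤ) :
    (∑ j ∈ s, P j).coeff i = ∑ j ∈ s, (P j).coeff i := by
  classical
  induction s using Finset.induction_on with
  | empty => rfl
  | insert a s ha ih => rw [Finset.sum_insert ha, Finset.sum_insert ha, coeff_add, ih]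

theorem coeff_C (a : A) (i : ℤ) : (C d a).coeff i = if i = 0 then a else 0 := rfl

theorem coeff_C_mul (a : A) (P : PDO d) (i : ℤ) : (C d a * P).coeff i = a * P.coeff i :=
  coeff_mulOp_mul a P i

theorem coeff_powD (j i : ℤ) : (powD d j).coeff i = if i = j then 1 else 0 := rfl

theorem val_D : ((D d : (PDO d)ˣ) : PDO d) = powD d 1 := rfl

theorem val_inv_D : (((D d)⁻¹ : (PDO d)ˣ) : PDO d) = powD d (-1) := rfl

theorem coeff_mul_D (P : PDO d) (i : ℤ) : (P * D d).coeff i = P.coeff (i - 1) :=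
  coeff_mul_powD P 1 i

theorem coeff_mul_inv_D (P : PDO d) (i : ℤ) :
    (P * ((D d)⁻¹ : (PDO d)ˣ)).coeff i = P.coeff (i + 1) := by
  rw [val_inv_D, coeff_mul_powD, sub_neg_eq_add]

theorem coeff_powD_mul (i : ℤ) (Q : PDO d) (n : ℤ) : (powD d i * Q).coeff n =
    ∑ᶠ m : ℕ, Ring.choose i m • d^[m] (Q.coeff (n - i + m)) := by
  obtain ⟨N, hN⟩ := Q.bdd
  rw [coeff_mul, finsum_eq_sum_of_support_subset
      (s := (Finset.range (N - n + i + 1).toNat).image fun m : ℕ => (i, m)),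
    Finset.sum_image (by simp), finsum_eq_sum_of_support_subset
      (s := Finset.range (N - n + i + 1).toNat)]
  · refine Finset.sum_congr rfl fun m _ => ?_
    simp [coeff_powD]
  · intro m hm
    simp only [Finset.coe_range, Set.mem_Iio]
    by_contra hc
    exact hm (by dsimp only; rw [hN _ (by omega), iterate_map_zero, smul_zero])
  · rintro ⟨a, m⟩ hm
    simp only [Finset.coe_image, Finset.coe_range, Set.mem_image, Set.mem_Iio, Prod.mk.injEq]
    have ha : a = i := by
      by_contra hc
      exact hm (by simp [coeff_powD, hc])
    subst ha
    refine ⟨m, ?_, rfl, rfl⟩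
    by_contra hc
    exact hm (by dsimp only; rw [hN _ (by omega), iterate_map_zero, mul_zero, smul_zero])

theorem coeff_powD_mul_C (i : ℤ) (f : A) (m : ℕ) :
    (powD d i * C d f).coeff (i - m) = Ring.choose i m • d^[m] f := by
  rw [coeff_powD_mul, finsum_eq_single _ m]
  · simp [coeff_C]
  · intro b hb
    rw [coeff_C, if_neg (by omega), iterate_map_zero, smul_zero]

theorem coeff_powD_mul_C_of_lt (i : ℤ) (f : A) (n : ℤ) (hn : i < n) :
    (powD d i * C d f).coeff n = 0 := by
  rw [coeff_powD_mul, ← finsum_zero (α := ℕ)]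
  refine finsum_congr fun b => ?_
  rw [coeff_C, if_neg (by omega), iterate_map_zero, smul_zero]

theorem coeff_D_mul (Q : PDO d) (n : ℤ) :
    ((D d : PDO d) * Q).coeff n = Q.coeff (n - 1) + d (Q.coeff n) := by
  rw [val_D, coeff_powD_mul, finsum_eq_sum_of_support_subset (s := Finset.range 2)]
  · simp [Finset.sum_range_succ]
  · intro m hm
    simp only [Finset.coe_range, Set.mem_Iio]
    by_contra hc
    refine hm ?_
    have : Ring.choose (1 : ℤ) m = 0 := by
      rw [← Nat.cast_one, Ring.choose_natCast, Nat.choose_eq_zero_of_lt (by omega), Nat.cast_zero]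
    dsimp only
    rw [this, zero_smul]

theorem choose_neg_one (k : ℕ) : Ring.choose (-1 : ℤ) k = (-1) ^ k := by
  rw [Ring.choose_neg, add_sub_cancel_left, Ring.choose_natCast, Nat.choose_self, Nat.cast_one,
    Units.smul_def, smul_eq_mul, mul_one, Int.negOnePow_def, zpow_natCast]
  simp

theorem D_mul_C (f : A) : (D d : PDO d) * C d f = C d f * D d + C d (d f) := by
  ext n
  rw [coeff_D_mul, coeff_add, coeff_mul_D]
  simp only [coeff_C]
  split_ifs <;> simp

theorem mul_inv_D_mul_D (P : PDO d) : P * ((D d)⁻¹ : (PDO d)ˣ) * D d = P := by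
  rw [mul_assoc, Units.inv_mul, mul_one]

theorem mul_D_mul_inv_D (P : PDO d) : P * D d * ((D d)⁻¹ : (PDO d)ˣ) = P := by
  rw [mul_assoc, Units.mul_inv, mul_one]

theorem inv_D_mul_D_mul (P : PDO d) : ((D d)⁻¹ : (PDO d)ˣ) * (D d * P) = P := by
  rw [← mul_assoc, Units.inv_mul, one_mul]

theorem D_mul_inv_D_mul (P : PDO d) : D d * (((D d)⁻¹ : (PDO d)ˣ) * P) = P := by
  rw [← mul_assoc, Units.mul_inv, one_mul]

/-- Integration by parts for operators: u' = Du - uD, placed between two factors D⁻¹. -/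
theorem inv_D_mul_C_deriv (u : A) : ((D d)⁻¹ : (PDO d)ˣ) * C d (d u) * ((D d)⁻¹ : (PDO d)ˣ) =
    C d u * ((D d)⁻¹ : (PDO d)ˣ) - ((D d)⁻¹ : (PDO d)ˣ) * C d u := by
  rw [eq_sub_of_add_eq' (D_mul_C (d := d) u).symm, mul_sub, sub_mul, inv_D_mul_D_mul,
    ← mul_assoc, mul_D_mul_inv_D]

/-- An operator without negative powers of `D`. -/
def IsDiff (P : PDO d) : Prop := ∀ i < 0, P.coeff i = 0

/-- An operator without non-negative powers of `D`. -/
def IsNeg (P : PDO d) : Prop := ∀ i, 0 ≤ i → P.coeff i = 0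

theorem coeff_pos (P : PDO d) (i : ℤ) : P.pos.coeff i = if 0 ≤ i then P.coeff i else 0 := rfl

theorem coeff_neg_part (P : PDO d) (i : ℤ) : P.neg.coeff i = if i < 0 then P.coeff i else 0 := rfl

theorem pos_add_neg (P : PDO d) : P.pos + P.neg = P := by
  ext i
  rw [coeff_add, coeff_pos, coeff_neg_part]
  split_ifs <;> first | omega | simp

theorem pos_add (P Q : PDO d) : (P + Q).pos = P.pos + Q.pos := by
  ext i
  simp only [coeff_pos, coeff_add]
  split_ifs <;> simp

theorem neg_part_add (P Q : PDO d) : (P + Q).neg = P.neg + Q.neg := by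
  ext i
  simp only [coeff_neg_part, coeff_add]
  split_ifs <;> simp

theorem neg_part_sub (P Q : PDO d) : (P - Q).neg = P.neg - Q.neg := by
  ext i
  simp only [coeff_neg_part, coeff_sub]
  split_ifs <;> simp

theorem neg_sum {ι : Type*} (s : Finset ι) (P : ι → PDO d) :
    (∑ j ∈ s, P j).neg = ∑ j ∈ s, (P j).neg := by
  ext i
  simp only [coeff_neg_part, coeff_sum]
  split_ifs <;> simp

theorem isDiff_pos (P : PDO d) : P.pos.IsDiff := fun _ hi => if_neg hi.not_ge

theorem isNeg_neg (P : PDO d) : P.neg.IsNeg := fun _ hi => if_neg hi.not_gt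

theorem IsDiff.neg_eq {P : PDO d} (h : P.IsDiff) : P.neg = 0 := by
  ext i
  rw [coeff_neg_part]
  split_ifs with hi
  · exact h i hi
  · rfl

theorem IsDiff.pos_eq {P : PDO d} (h : P.IsDiff) : P.pos = P := by
  rw [← add_zero P.pos, ← h.neg_eq, pos_add_neg]

theorem IsNeg.pos_eq {P : PDO d} (h : P.IsNeg) : P.pos = 0 := by
  ext i
  rw [coeff_pos]
  split_ifs with hi
  · exact h i hi
  · rfl

theorem IsNeg.neg_eq {P : PDO d} (h : P.IsNeg) : P.neg = P := by
  rw [← zero_add P.neg, ← h.pos_eq, pos_add_neg]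

theorem isDiff_C (a : A) : (C d a).IsDiff := fun _ hi => if_neg hi.ne

theorem isDiff_D : (D d : PDO d).IsDiff := fun i hi => by
  rw [val_D, coeff_powD, if_neg (by omega)]

theorem IsDiff.sub {P Q : PDO d} (hP : P.IsDiff) (hQ : Q.IsDiff) : (P - Q).IsDiff := fun i hi => by
  rw [coeff_sub, hP i hi, hQ i hi, sub_zero]

theorem IsDiff.mul {P Q : PDO d} (hP : P.IsDiff) (hQ : Q.IsDiff) : (P * Q).IsDiff := by
  intro n hn
  rw [coeff_mul, ← finsum_zero (α := ℤ × ℕ)]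
  refine finsum_congr fun p => ?_
  rcases lt_or_ge p.1 0 with h | h
  · rw [hP _ h, zero_mul, smul_zero]
  rcases lt_or_ge p.1 p.2 with h' | h'
  · lift p.1 to ℕ using h with a ha
    rw [Ring.choose_natCast, Nat.choose_eq_zero_of_lt (by omega), Nat.cast_zero, zero_smul]
  · rw [hQ _ (by omega), iterate_map_zero, mul_zero, smul_zero]

theorem IsNeg.mul_C {P : PDO d} (hP : P.IsNeg) (a : A) : (P * C d a).IsNeg := fun i hi =>
  bound_mul (M := -1) (N := 0) (fun j hj => hP j (by omega)) (fun _ hj => if_neg hj.ne') i (by omega)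

theorem IsNeg.C_mul {P : PDO d} (hP : P.IsNeg) (a : A) : (C d a * P).IsNeg := fun i hi => by
  rw [coeff_C_mul, hP i hi, mul_zero]

theorem IsNeg.mul {P Q : PDO d} (hP : P.IsNeg) (hQ : Q.IsNeg) : (P * Q).IsNeg := fun i hi =>
  bound_mul (M := -1) (N := -1) (fun j hj => hP j (by omega)) (fun j hj => hQ j (by omega))
    i (by omega)

theorem isNeg_inv_D : (((D d)⁻¹ : (PDO d)ˣ) : PDO d).IsNeg := fun i hi => by
  rw [val_inv_D, coeff_powD, if_neg (by omega)]

theorem pos_eq_sum (P : PDO d) : ∃ N : ℕ, (∀ n : ℕ, N ≤ n → P.coeff n = 0) ∧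
    P.pos = ∑ n ∈ Finset.range N, C d (P.coeff n) * powD d n := by
  obtain ⟨N, h0, hN⟩ := P.exists_bound 0
  refine ⟨(N + 1).toNat, fun n hn => hN _ (by omega), ?_⟩
  ext i
  rw [coeff_sum]
  simp only [coeff_C_mul, coeff_powD, mul_ite, mul_one, mul_zero, coeff_pos]
  split_ifs with hi
  · lift i to ℕ using hi
    simp only [Nat.cast_inj, Finset.sum_ite_eq, Finset.mem_range]
    split_ifs with h
    · rfl
    · exact hN _ (by omega)
  · refine (Finset.sum_eq_zero fun n _ => if_neg (by omega)).symm

theorem posApply_eq_sum (P : PDO d) (N : ℕ) (h : ∀ n : ℕ, N ≤ n → P.coeff n = 0) (f : A) :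
    P.posApply f = ∑ n ∈ Finset.range N, P.coeff n * d^[n] f := by
  refine finsum_eq_sum_of_support_subset _ fun n hn => ?_
  simp only [Finset.coe_range, Set.mem_Iio]
  by_contra hc
  exact hn (by dsimp only; rw [h n (by omega), zero_mul])

/-- Actions, adjoints and concomitants are all read off from products of operators, so that their
composition rules follow from associativity. -/
theorem posApply_eq_coeff (P : PDO d) (f : A) : P.posApply f = (P.pos * C d f).coeff 0 := by
  obtain ⟨N, hN, hP⟩ := P.pos_eq_sum
  rw [posApply_eq_sum P N hN, hP, Finset.sum_mul, coeff_sum]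
  refine Finset.sum_congr rfl fun n _ => ?_
  have := coeff_powD_mul_C (d := d) n f n
  rw [sub_self, Ring.choose_natCast, Nat.choose_self, Nat.cast_one, one_smul] at this
  rw [mul_assoc, coeff_C_mul, this]

theorem posAdjApply_eq_coeff (P : PDO d) (g : A) :
    P.posAdjApply g = ((((D d)⁻¹ : (PDO d)ˣ) : PDO d) * C d g * P.pos).coeff (-1) := by
  obtain ⟨N, hN, hP⟩ := P.pos_eq_sum
  rw [hP, Finset.mul_sum, coeff_sum, posAdjApply, finsum_eq_sum_of_support_subset
    (s := Finset.range N)]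
  · refine Finset.sum_congr rfl fun n _ => ?_
    rw [← mul_assoc, coeff_mul_powD, mul_assoc, ← map_mul, val_inv_D, coeff_powD_mul_C,
      choose_neg_one, mul_comm g]
    simp
  · intro n hn
    simp only [Finset.coe_range, Set.mem_Iio]
    by_contra hc
    exact hn (by dsimp only; rw [hN n (by omega), zero_mul, iterate_map_zero, mul_zero])

theorem posApply_add (P Q : PDO d) (f : A) :
    (P + Q).posApply f = P.posApply f + Q.posApply f := by
  rw [posApply_eq_coeff, posApply_eq_coeff, posApply_eq_coeff, pos_add, _root_.add_mul, coeff_add]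

theorem posApply_zero (f : A) : (0 : PDO d).posApply f = 0 := by
  simp [posApply]

theorem posApply_sub (P Q : PDO d) (f : A) :
    (P - Q).posApply f = P.posApply f - Q.posApply f := by
  rw [eq_sub_iff_add_eq, ← posApply_add, sub_add_cancel]

theorem posApply_sum {ι : Type*} (s : Finset ι) (P : ι → PDO d) (f : A) :
    (∑ j ∈ s, P j).posApply f = ∑ j ∈ s, (P j).posApply f := by
  classical
  induction s using Finset.induction_on with
  | empty => exact posApply_zero f
  | insert a s ha ih => rw [Finset.sum_insert ha, Finset.sum_insert ha, posApply_add, ih]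

theorem posApply_pos (P : PDO d) (f : A) : P.pos.posApply f = P.posApply f := by
  rw [posApply_eq_coeff, posApply_eq_coeff, (isDiff_pos P).pos_eq]

theorem IsNeg.posApply_eq {P : PDO d} (hP : P.IsNeg) (f : A) : P.posApply f = 0 := by
  rw [← posApply_pos, hP.pos_eq, posApply_zero]

theorem posApply_add_right (P : PDO d) (f g : A) :
    P.posApply (f + g) = P.posApply f + P.posApply g := by
  simp only [posApply_eq_coeff, map_add, _root_.mul_add, coeff_add]

theorem posApply_zero_right (P : PDO d) : P.posApply 0 = 0 := by
  rw [posApply_eq_coeff, map_zero, mul_zero]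
  rfl

theorem posApply_C (a f : A) : (C d a).posApply f = a * f := by
  rw [posApply_eq_coeff, (isDiff_C a).pos_eq, coeff_C_mul, coeff_C, if_pos rfl]

theorem posApply_D (f : A) : (D d : PDO d).posApply f = d f := by
  rw [posApply_eq_coeff, isDiff_D.pos_eq, coeff_D_mul, coeff_C, coeff_C]
  simp

theorem IsDiff.sub_C_mul_inv_D {P : PDO d} (hP : P.IsDiff) :
    ((P - C d (P.coeff 0)) * ((D d)⁻¹ : (PDO d)ˣ)).IsDiff := by
  intro i hi
  rw [coeff_mul_inv_D, coeff_sub, coeff_C]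
  split_ifs with h
  · rw [h, sub_self]
  · rw [hP _ (by omega), sub_zero]

/-- Division of the differential operator `P f` by `D` from the right has the remainder `P(f)`. -/
theorem IsDiff.isDiff_sub {P : PDO d} (hP : P.IsDiff) (f : A) :
    ((P * C d f - C d (P.posApply f)) * ((D d)⁻¹ : (PDO d)ˣ)).IsDiff := by
  rw [posApply_eq_coeff, hP.pos_eq]
  exact (hP.mul (isDiff_C f)).sub_C_mul_inv_D

theorem IsDiff.neg_mul_C_mul_inv_D {P : PDO d} (hP : P.IsDiff) (f : A) :
    (P * C d f * ((D d)⁻¹ : (PDO d)ˣ)).neg = C d (P.posApply f) * ((D d)⁻¹ : (PDO d)ˣ) := by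
  have h := (hP.isDiff_sub f).neg_eq
  rw [sub_mul, neg_part_sub, sub_eq_zero, (isNeg_inv_D.C_mul _).neg_eq] at h
  exact h

/-- Since Qf = RD + Q(f) with R differential, PQf and P·Q(f) differ by a differential operator times
D, which has no constant coefficient. -/
theorem IsDiff.posApply_mul {P Q : PDO d} (hP : P.IsDiff) (hQ : Q.IsDiff) (f : A) :
    (P * Q).posApply f = P.posApply (Q.posApply f) := by
  have hR := hQ.isDiff_sub f
  set R := (Q * C d f - C d (Q.posApply f)) * ((D d)⁻¹ : (PDO d)ˣ) with hRdef
  have h : Q * C d f = R * D d + C d (Q.posApply f) := by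
    rw [hRdef, mul_inv_D_mul_D, sub_add_cancel]
  rw [posApply_eq_coeff, (hP.mul hQ).pos_eq, mul_assoc, h, _root_.mul_add, ← mul_assoc, coeff_add,
    coeff_mul_D, (hP.mul hR) _ (by norm_num), zero_add, posApply_eq_coeff P, hP.pos_eq]

theorem neg_mul_C (P : PDO d) (f : A) : (P * C d f).neg = P.neg * C d f := by
  conv_lhs => rw [← pos_add_neg P, _root_.add_mul, neg_part_add,
    ((isDiff_pos P).mul (isDiff_C f)).neg_eq, ((isNeg_neg P).mul_C f).neg_eq, zero_add]

theorem neg_C_mul (P : PDO d) (f : A) : (C d f * P).neg = C d f * P.neg := by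
  ext i
  rw [coeff_neg_part, coeff_C_mul, coeff_C_mul, coeff_neg_part]
  split_ifs <;> simp

theorem pos_C_mul (P : PDO d) (f : A) : (C d f * P).pos = C d f * P.pos := by
  ext i
  rw [coeff_pos, coeff_C_mul, coeff_C_mul, coeff_pos]
  split_ifs <;> simp

theorem coeff_inv_D_mul_C (a : A) :
    ((((D d)⁻¹ : (PDO d)ˣ) : PDO d) * C d a).coeff (-1) = a := by
  have := coeff_powD_mul_C (d := d) (-1) a 0
  simpa [val_inv_D] using this

/-- Division of a differential operator by `D` from the left. -/
theorem IsDiff.neg_inv_D_mul {U : PDO d} (hU : U.IsDiff) :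
    (((D d)⁻¹ : (PDO d)ˣ) * U).neg =
      ((D d)⁻¹ : (PDO d)ˣ) * C d ((((D d)⁻¹ : (PDO d)ˣ) * U).coeff (-1)) := by
  set V : PDO d := ((D d)⁻¹ : (PDO d)ˣ) * U with hV
  have h1 : D d * V.neg = U - D d * V.pos := by
    rw [eq_sub_iff_add_eq, ← _root_.mul_add, add_comm, pos_add_neg, hV, D_mul_inv_D_mul]
  -- D V₋ equals U - D V₊, hence is differential, and its order is at most zero: it is a function.
  have h2 : D d * V.neg = C d ((D d * V.neg).coeff 0) := by
    ext i
    rw [coeff_C]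
    split_ifs with hi
    · rw [hi]
    · rcases lt_or_gt_of_ne hi with h | h
      · rw [h1]
        exact (hU.sub (isDiff_D.mul (isDiff_pos V))) i h
      · rw [coeff_D_mul, isNeg_neg V _ (by omega), isNeg_neg V _ (by omega), map_zero, zero_add]
  have h3 : (D d * V.neg).coeff 0 = V.coeff (-1) := by
    rw [coeff_D_mul, isNeg_neg V 0 le_rfl, map_zero, add_zero]
    rfl
  rw [h3] at h2
  rw [← h2, inv_D_mul_D_mul]

theorem IsDiff.neg_inv_D_mul_C_mul {P : PDO d} (hP : P.IsDiff) (g : A) :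
    (((D d)⁻¹ : (PDO d)ˣ) * C d g * P).neg = ((D d)⁻¹ : (PDO d)ˣ) * C d (P.posAdjApply g) := by
  rw [posAdjApply_eq_coeff, hP.pos_eq, mul_assoc, ((isDiff_C g).mul hP).neg_inv_D_mul]

theorem posAdjApply_pos (P : PDO d) (g : A) : P.pos.posAdjApply g = P.posAdjApply g := by
  rw [posAdjApply_eq_coeff, posAdjApply_eq_coeff, (isDiff_pos P).pos_eq]

/-- D⁻¹ g P₊ is a differential quotient plus the remainder D⁻¹ (P₊)*(g). Expanding D⁻¹(g pₙ)Dⁿ with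
the binomials (-1 choose k) = (-1)ᵏ shows that the quotient, applied to f, is the alternating sum of
the concomitant. -/
theorem concomitant_eq (P : PDO d) (f g : A) :
    P.concomitant f g = (((D d)⁻¹ : (PDO d)ˣ) * C d g * P.pos).posApply f := by
  obtain ⟨N, hN, hP⟩ := P.pos_eq_sum
  rw [hP, Finset.mul_sum, posApply_sum, concomitant, finsum_eq_sum_of_support_subset
    (s := Finset.range N)]
  · refine Finset.sum_congr rfl fun n _ => ?_
    rw [posApply_eq_sum _ n, ← Finset.sum_range_reflect]
    · refine Finset.sum_congr rfl fun k hk => ?_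
      rw [Finset.mem_range] at hk
      have h : ((k : ℕ) : ℤ) - n = -1 - (n - 1 - k : ℕ) := by omega
      rw [← mul_assoc (((D d)⁻¹ : (PDO d)ˣ) * C d g : PDO d), coeff_mul_powD,
        mul_assoc (((D d)⁻¹ : (PDO d)ˣ) : PDO d), ← map_mul, val_inv_D, h, coeff_powD_mul_C,
        choose_neg_one, mul_comm g, show n - 1 - (n - 1 - k) = k by omega]
      simp
    · intro m hm
      rw [← mul_assoc, coeff_mul_powD, mul_assoc, ← map_mul, val_inv_D,
        coeff_powD_mul_C_of_lt _ _ _ (by omega)]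
  · intro n hn
    simp only [Finset.coe_range, Set.mem_Iio]
    by_contra hc
    exact hn (Finset.sum_eq_zero fun k _ => by
      rw [hN n (by omega), zero_mul, iterate_map_zero, mul_zero, zero_mul])

theorem concomitant_pos (P : PDO d) (f g : A) : P.pos.concomitant f g = P.concomitant f g := by
  rw [concomitant_eq, concomitant_eq, (isDiff_pos P).pos_eq]

/-- Split D⁻¹ g P into quotient and remainder: the quotient acts on Q(f), and the remainder D⁻¹
P*(g) times Q starts the division for Q. -/
theorem IsDiff.concomitant_mul {P Q : PDO d} (hP : P.IsDiff) (hQ : Q.IsDiff) (f g : A) :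
    (P * Q).concomitant f g =
      P.concomitant (Q.posApply f) g + Q.concomitant f (P.posAdjApply g) := by
  rw [concomitant_eq, concomitant_eq, concomitant_eq, hP.pos_eq, hQ.pos_eq, (hP.mul hQ).pos_eq,
    ← mul_assoc, ← pos_add_neg ((((D d)⁻¹ : (PDO d)ˣ) : PDO d) * C d g * P), _root_.add_mul, posApply_add,
    (isDiff_pos _).posApply_mul hQ, hP.neg_inv_D_mul_C_mul, posApply_add,
    (isNeg_inv_D.mul_C _).posApply_eq, add_zero]

theorem concomitant_add (P Q : PDO d) (f g : A) :
    (P + Q).concomitant f g = P.concomitant f g + Q.concomitant f g := by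
  rw [concomitant_eq, concomitant_eq, concomitant_eq, pos_add, _root_.mul_add, posApply_add]

theorem concomitant_C (a f g : A) : (C d a).concomitant f g = 0 := by
  rw [concomitant_eq, (isDiff_C a).pos_eq, mul_assoc, ← map_mul]
  exact (isNeg_inv_D.mul_C _).posApply_eq f

theorem concomitant_C_mul_D_mul_C (a b f g : A) :
    (C d a * D d * C d b).concomitant f g = g * a * b * f := by
  have h : ((D d)⁻¹ : (PDO d)ˣ) * C d g * (C d a * D d * C d b) =
      C d (g * a * b) - ((D d)⁻¹ : (PDO d)ˣ) * C d (d (g * a) * b) := by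
    rw [← mul_assoc, ← mul_assoc, mul_assoc (((D d)⁻¹ : (PDO d)ˣ) : PDO d), ← map_mul,
      mul_assoc (((D d)⁻¹ : (PDO d)ˣ) : PDO d), eq_sub_of_add_eq (D_mul_C (d := d) (g * a)).symm,
      mul_sub, inv_D_mul_D_mul, sub_mul, ← map_mul,
      mul_assoc (((D d)⁻¹ : (PDO d)ˣ) : PDO d), ← map_mul]
  rw [concomitant_eq, (((isDiff_C a).mul isDiff_D).mul (isDiff_C b)).pos_eq, h, posApply_sub,
    (isNeg_inv_D.mul_C _).posApply_eq, posApply_C, sub_zero]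

theorem concomitant_zero_left (P : PDO d) (g : A) : P.concomitant 0 g = 0 := by
  rw [concomitant_eq, posApply_zero_right]

/-- With R the quotient of Pu by D, the left side is R(vf) = R(D(S)) = (Pu - P(u))(S), whatever
antiderivative S is chosen. -/
theorem posApply_mul_neg {P : PDO d} (hP : P.IsDiff) (u v f S : A) (hS : d S = v * f) :
    (P * (C d u * ((D d)⁻¹ : (PDO d)ˣ) * C d v)).posApply f =
      P.posApply (u * S) - P.posApply u * S := by
  have hR := hP.isDiff_sub u
  set R := (P * C d u - C d (P.posApply u)) * ((D d)⁻¹ : (PDO d)ˣ) with hRdef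
  have h : P * (C d u * ((D d)⁻¹ : (PDO d)ˣ) * C d v) =
      R * C d v + C d (P.posApply u) * (((D d)⁻¹ : (PDO d)ˣ) * C d v) := by
    rw [hRdef]
    noncomm_ring
  rw [h, posApply_add, ((isNeg_inv_D.mul_C v).C_mul _).posApply_eq, add_zero,
    hR.posApply_mul (isDiff_C v), posApply_C, ← hS, ← posApply_D, ← hR.posApply_mul isDiff_D,
    hRdef, mul_inv_D_mul_D, posApply_sub, hP.posApply_mul (isDiff_C u), posApply_C, posApply_C]

end PDO

namespace CKP

open PDO

variable {A : Type*} [CommRing A] {d : Derivation ℤ A A}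

/-! ### The Darboux-Bäcklund operator -/

theorem val_darboux (Φ : Aˣ) :
    (darboux d Φ : PDO d) = C d Φ * D d * C d (Φ⁻¹ : Aˣ) := rfl

theorem val_inv_darboux (Φ : Aˣ) : ((darboux d Φ)⁻¹ : (PDO d)ˣ) =
    C d Φ * ((D d)⁻¹ : (PDO d)ˣ) * C d (Φ⁻¹ : Aˣ) := by
  rw [darboux, mul_inv_rev, mul_inv_rev, inv_inv]
  simp [mul_assoc]

theorem C_inv_mul_C (Φ : Aˣ) (P : PDO d) : C d (Φ⁻¹ : Aˣ) * (C d (Φ : A) * P) = P := by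
  rw [← mul_assoc, ← map_mul, Units.inv_mul, map_one, one_mul]

theorem isDiff_darboux (Φ : Aˣ) : (darboux d Φ : PDO d).IsDiff :=
  ((isDiff_C _).mul isDiff_D).mul (isDiff_C _)

theorem posApply_darboux (Φ : Aˣ) (f : A) :
    (darboux d Φ : PDO d).posApply f = Φ * d ((Φ⁻¹ : Aˣ) * f) := by
  rw [val_darboux, ((isDiff_C _).mul isDiff_D).posApply_mul (isDiff_C _),
    (isDiff_C _).posApply_mul isDiff_D, posApply_C, posApply_D, posApply_C]

theorem posApply_darboux_self (Φ : Aˣ) : (darboux d Φ : PDO d).posApply (Φ : A) = 0 := by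
  rw [posApply_darboux, Units.inv_mul, d.map_one_eq_zero, mul_zero]

theorem posApply_darboux_mul (Φ : Aˣ) (f S : A) : (darboux d Φ : PDO d).posApply (f * S) =
    f * d S + (darboux d Φ : PDO d).posApply f * S := by
  rw [posApply_darboux, posApply_darboux, ← mul_assoc, d.leibniz, smul_eq_mul, smul_eq_mul,
    _root_.mul_add, ← mul_assoc, ← mul_assoc, Units.mul_inv, one_mul]
  ring

theorem posAdjApply_darboux (Φ : Aˣ) (g : A) :
    (darboux d Φ : PDO d).posAdjApply g = -((Φ⁻¹ : Aˣ) * d (Φ * g)) := by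
  have h : ((D d)⁻¹ : (PDO d)ˣ) * C d g * (darboux d Φ : PDO d) =
      C d (g * Φ * (Φ⁻¹ : Aˣ)) - ((D d)⁻¹ : (PDO d)ˣ) * C d ((Φ⁻¹ : Aˣ) * d (Φ * g)) := by
    have h1 : ((D d)⁻¹ : (PDO d)ˣ) * (C d (g * Φ) * D d) =
        C d (g * Φ) - ((D d)⁻¹ : (PDO d)ˣ) * C d (d (g * Φ)) := by
      rw [eq_sub_of_add_eq (D_mul_C (d := d) (g * Φ)).symm, mul_sub, inv_D_mul_D_mul]
    rw [val_darboux, ← mul_assoc, ← mul_assoc, mul_assoc _ (C d g), ← map_mul, mul_assoc _ (C d _),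
      h1, sub_mul, ← map_mul, mul_assoc _ (C d _), ← map_mul, mul_comm (Φ : A), mul_comm (d _)]
  rw [posAdjApply_eq_coeff, (isDiff_darboux Φ).pos_eq, h, coeff_sub, coeff_inv_D_mul_C, coeff_C,
    if_neg (by norm_num), zero_sub]

theorem concomitant_darboux (Φ : Aˣ) (f g : A) :
    (darboux d Φ : PDO d).concomitant f g = g * f := by
  rw [val_darboux, concomitant_C_mul_D_mul_C, mul_assoc g, Units.mul_inv, mul_one]

theorem conj_mul (Φ : Aˣ) (P Q : PDO d) : conj Φ (P * Q) = conj Φ P * conj Φ Q := by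
  simp only [conj, mul_assoc, Units.inv_mul_cancel_left]

theorem conj_add (Φ : Aˣ) (P Q : PDO d) : conj Φ (P + Q) = conj Φ P + conj Φ Q := by
  simp only [conj, _root_.mul_add, _root_.add_mul]

theorem conj_neg (Φ : Aˣ) (P : PDO d) : conj Φ (-P) = -conj Φ P := by
  simp only [conj, mul_neg, neg_mul]

theorem conj_sub (Φ : Aˣ) (P Q : PDO d) : conj Φ (P - Q) = conj Φ P - conj Φ Q := by
  simp only [conj, mul_sub, sub_mul]

theorem conj_one (Φ : Aˣ) : conj Φ (1 : PDO d) = 1 := by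
  rw [conj, mul_one, Units.mul_inv]

theorem conj_pow (Φ : Aˣ) (P : PDO d) (n : ℕ) : conj Φ (P ^ n) = conj Φ P ^ n := by
  induction n with
  | zero => rw [pow_zero, pow_zero, conj_one]
  | succ n ih => rw [pow_succ, pow_succ, conj_mul, ih]

theorem conj_sum {ι : Type*} (Φ : Aˣ) (s : Finset ι) (P : ι → PDO d) :
    conj Φ (∑ j ∈ s, P j) = ∑ j ∈ s, conj Φ (P j) := by
  simp only [conj, Finset.mul_sum, Finset.sum_mul]

theorem conj_mul_darboux (Φ : Aˣ) (P : PDO d) :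
    conj Φ P * darboux d Φ = darboux d Φ * P := by
  rw [conj, Units.inv_mul_cancel_right]

theorem neg_conj_of_isDiff (Φ : Aˣ) {P : PDO d} (hP : P.IsDiff) : (conj Φ P).neg =
    C d ((darboux d Φ : PDO d).posApply (P.posApply (Φ : A))) * ((D d)⁻¹ : (PDO d)ˣ) *
      C d (Φ⁻¹ : Aˣ) := by
  have hTP := (isDiff_darboux Φ).mul hP
  rw [conj, val_inv_darboux, ← mul_assoc, ← mul_assoc, neg_mul_C, hTP.neg_mul_C_mul_inv_D,
    (isDiff_darboux Φ).posApply_mul hP]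

theorem isNeg_conj (Φ : Aˣ) {P : PDO d} (hP : P.IsNeg) : (conj Φ P).IsNeg := by
  have hT : ∀ i, (1 : ℤ) < i → (darboux d Φ : PDO d).coeff i = 0 := fun i hi =>
    bound_mul (M := 1) (N := 0) (P := C d (Φ : A) * (D d : PDO d))
      (fun j hj => by rw [coeff_mul_D, coeff_C, if_neg (by omega)]) (fun _ hj => if_neg hj.ne') i
        (by omega)
  have hT' : ∀ i, (-1 : ℤ) < i → (((darboux d Φ)⁻¹ : (PDO d)ˣ) : PDO d).coeff i = 0 := by
    intro i hi
    rw [val_inv_darboux]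
    exact (isNeg_inv_D.C_mul _).mul_C _ i (by omega)
  exact fun i hi => bound_mul (M := 0) (N := -1)
    (fun j hj => bound_mul (M := 1) (N := -1) hT (fun k hk => hP k (by omega)) j (by omega))
      hT' i (by omega)

/-- Conjugation by T does not raise the order, so T P₋ T⁻¹ is already negative. The correction is
the remainder of T P₊ Φ on right division by D. -/
theorem neg_conj (Φ : Aˣ) (P : PDO d) : (conj Φ P).neg = conj Φ P.neg +
    C d ((darboux d Φ : PDO d).posApply (P.posApply (Φ : A))) * ((D d)⁻¹ : (PDO d)ˣ) *
      C d (Φ⁻¹ : Aˣ) := by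
  conv_lhs => rw [← pos_add_neg P, conj_add, neg_part_add, neg_conj_of_isDiff Φ (isDiff_pos P),
    (isNeg_conj Φ (isNeg_neg P)).neg_eq, add_comm, posApply_pos]

theorem darboux_mul_C (Φ : Aˣ) (f : A) : (darboux d Φ : PDO d) * C d f =
    C d f * (D d : PDO d) + C d ((darboux d Φ : PDO d).posApply f) := by
  rw [posApply_darboux, val_darboux, mul_assoc, ← map_mul, mul_assoc, D_mul_C, _root_.mul_add,
    ← mul_assoc, ← map_mul, ← map_mul, ← mul_assoc (Φ : A), Units.mul_inv, one_mul]

/-- The conjugate of `f D⁻¹ ψ` in terms of an antiderivative `S` of `Φ ψ`. -/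
theorem conj_rank_one (Φ : Aˣ) (f ψ S : A) (hS : d S = Φ * ψ) :
    conj Φ (C d f * ((D d)⁻¹ : (PDO d)ˣ) * C d ψ : PDO d) =
      C d ((darboux d Φ : PDO d).posApply (f * S)) * ((D d)⁻¹ : (PDO d)ˣ) * C d (Φ⁻¹ : Aˣ) +
      C d ((darboux d Φ : PDO d).posApply f) * ((D d)⁻¹ : (PDO d)ˣ) *
        C d (-((Φ⁻¹ : Aˣ) * S)) := by
  have h1 : C d ψ * (C d (Φ : A)) = C d (d S) := by rw [← map_mul, hS, mul_comm]
  have h2 : C d (-((Φ⁻¹ : Aˣ) * S)) = -(C d S * C d (Φ⁻¹ : Aˣ)) := by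
    rw [map_neg, mul_comm, map_mul]
  -- T f = f D + T(f) splits the product. In the second summand ψΦ = S' stands between two factors
  -- D⁻¹ and is integrated by parts; f S' + T(f) S is T(fS).
  rw [conj, ← mul_assoc, ← mul_assoc, darboux_mul_C, _root_.add_mul (C d f * _),
    mul_D_mul_inv_D, posApply_darboux_mul, val_inv_darboux, map_add, map_mul, map_mul, h2]
  calc _ = (C d f + C d ((darboux d Φ : PDO d).posApply f) * ((D d)⁻¹ : (PDO d)ˣ)) *
        (C d ψ * C d (Φ : A)) * ((D d)⁻¹ : (PDO d)ˣ) * C d (Φ⁻¹ : Aˣ) := by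
          simp only [mul_assoc]
    _ = C d f * C d (d S) * ((D d)⁻¹ : (PDO d)ˣ) * C d (Φ⁻¹ : Aˣ) +
        C d ((darboux d Φ : PDO d).posApply f) *
          (((D d)⁻¹ : (PDO d)ˣ) * C d (d S) * ((D d)⁻¹ : (PDO d)ˣ)) * C d (Φ⁻¹ : Aˣ) := by
          rw [h1]; noncomm_ring
    _ = _ := by rw [inv_D_mul_C_deriv]; noncomm_ring

/-- If `P' T = Q` then the adjoint of `P'` is a concomitant of `Q`. -/
theorem posAdjApply_of_mul_darboux (Φ : Aˣ) {P' Q : PDO d} (hP' : P'.IsDiff)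
    (h : P' * darboux d Φ = Q) (g : A) :
    P'.posAdjApply g = (Φ⁻¹ : Aˣ) * Q.concomitant Φ g := by
  -- In the product rule T(Φ) = 0 removes one term, and the concomitant of T is multiplication, so
  -- the other is Φ·P'*(g).
  rw [← h, hP'.concomitant_mul (isDiff_darboux Φ), posApply_darboux_self, concomitant_zero_left,
    zero_add, concomitant_darboux, mul_comm (P'.posAdjApply g), ← mul_assoc, Units.inv_mul, one_mul]

theorem concomitant_of_mul_darboux (Φ : Aˣ) {P' Q : PDO d} (hP' : P'.IsDiff)
    (h : P' * darboux d Φ = Q) (f g : A) :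
    P'.concomitant ((darboux d Φ : PDO d).posApply f) g =
      Q.concomitant f g - P'.posAdjApply g * f := by
  rw [← h, hP'.concomitant_mul (isDiff_darboux Φ), concomitant_darboux, add_sub_cancel_right]

/-- The variation of `T = Φ D Φ⁻¹` when `Φ` moves with velocity `φ`. -/
noncomputable def darbouxVar (d : Derivation ℤ A A) (Φ : Aˣ) (φ : A) : PDO d :=
  C d φ * D d * C d (Φ⁻¹ : Aˣ) - C d Φ * D d * C d ((Φ⁻¹ : Aˣ) * (Φ⁻¹ : Aˣ) * φ)

/-- As δT = φDΦ⁻¹ - TφΦ⁻¹ and Tφ = φD + T(φ), the variation δT is the function -T(φ)Φ⁻¹. -/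
theorem darbouxVar_mul_inv (Φ : Aˣ) (φ : A) :
    darbouxVar d Φ φ * ((darboux d Φ)⁻¹ : (PDO d)ˣ) =
      -(C d ((darboux d Φ : PDO d).posApply φ) * ((D d)⁻¹ : (PDO d)ˣ) * C d (Φ⁻¹ : Aˣ)) := by
  rw [Units.mul_inv_eq_iff_eq_mul, val_darboux, neg_mul]
  have h1 : C d (Φ⁻¹ : Aˣ) * (C d Φ * D d * C d (Φ⁻¹ : Aˣ)) = D d * C d (Φ⁻¹ : Aˣ) := by
    rw [mul_assoc, C_inv_mul_C]
  have h2 : C d Φ * D d * C d ((Φ⁻¹ : Aˣ) * (Φ⁻¹ : Aˣ) * φ) =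
      (C d Φ * D d * C d (Φ⁻¹ : Aˣ)) * C d φ * C d (Φ⁻¹ : Aˣ) := by
    rw [mul_assoc (_ * _), mul_assoc (_ * _), ← map_mul, ← map_mul]
    congr 2
    ring
  rw [mul_assoc, h1, ← mul_assoc, mul_inv_D_mul_D, darbouxVar, h2, ← val_darboux, darboux_mul_C]
  noncomm_ring

/-! ### The transformed nonlocal functions -/

section Nonlocal

variable {Φ : Aˣ} {Ψ : A} {L : PDO d}

theorem neg_conj_lax (hL : L.neg = C d Φ * ((D d)⁻¹ : (PDO d)ˣ) * C d Ψ)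
    (p : NonlocalAction L Φ Ψ) : (conj Φ L).neg =
      C d ((darboux d Φ : PDO d).posApply (p.φ 1)) * ((D d)⁻¹ : (PDO d)ˣ) * C d (Φ⁻¹ : Aˣ) := by
  have hS : d (p.S 0 0) = Φ * Ψ := by rw [p.deriv_S, p.φ_zero, p.ψ_zero]
  rw [neg_conj, hL, conj_rank_one Φ _ _ _ hS, posApply_darboux_self, map_zero, zero_mul, zero_mul,
    add_zero, p.φ_succ, p.φ_zero, posApply_add_right, map_add, _root_.add_mul, _root_.add_mul,
    add_comm]

/-- In L̃T = TL the negative parts contribute functions only: L̃₋T = Φ̃Φ⁻¹ and TL₋ = ΦΨ. This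
intertwining relation carries the actions and concomitants of L₊ over to L̃₊. -/
theorem pos_conj_mul_darboux (hL : L.neg = C d Φ * ((D d)⁻¹ : (PDO d)ˣ) * C d Ψ)
    (p : NonlocalAction L Φ Ψ) : (conj Φ L).pos * darboux d Φ =
      darboux d Φ * L.pos +
        C d (Φ * Ψ - (darboux d Φ : PDO d).posApply (p.φ 1) * (Φ⁻¹ : Aˣ)) := by
  have h1 : (conj Φ L).pos * darboux d Φ + (conj Φ L).neg * darboux d Φ =
      darboux d Φ * L.pos + darboux d Φ * L.neg := by
    rw [← _root_.add_mul, ← _root_.mul_add, pos_add_neg, pos_add_neg, conj_mul_darboux]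
  have h2 : (conj Φ L).neg * darboux d Φ =
      C d ((darboux d Φ : PDO d).posApply (p.φ 1) * (Φ⁻¹ : Aˣ)) := by
    rw [neg_conj_lax hL p, val_darboux, mul_assoc, mul_assoc (C d (Φ : A)), C_inv_mul_C, mul_assoc,
      inv_D_mul_D_mul, map_mul]
  have h3 : darboux d Φ * L.neg = C d (Φ * Ψ) := by
    rw [hL, ← mul_assoc, ← mul_assoc, darboux_mul_C, posApply_darboux_self, map_zero, add_zero,
      mul_D_mul_inv_D, map_mul]
  rw [map_sub, eq_sub_of_add_eq h1, h2, h3]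
  abel

theorem concomitant_darboux_mul (f g c : A) :
    (darboux d Φ * L.pos + C d c).concomitant f g =
      g * L.posApply f + L.concomitant f (-((Φ⁻¹ : Aˣ) * d (Φ * g))) := by
  rw [concomitant_add, concomitant_C, add_zero,
    (isDiff_darboux Φ).concomitant_mul (isDiff_pos L), concomitant_darboux, concomitant_pos,
    posApply_pos, posAdjApply_darboux]

/-- The nonlocal term of φ (i+1) contributes T(Φ S) = Φ S' = ΦΨ φ i, which matches the function ΦΨ
in the intertwining relation. At index i+1 this is the recursion for L̃ⁱ(Φ̃). -/
theorem posApply_pos_conj (hL : L.neg = C d Φ * ((D d)⁻¹ : (PDO d)ˣ) * C d Ψ)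
    (p : NonlocalAction L Φ Ψ) (i : ℕ) :
    (darboux d Φ : PDO d).posApply (p.φ (i + 1)) =
      (conj Φ L).posApply ((darboux d Φ : PDO d).posApply (p.φ i)) +
        (darboux d Φ : PDO d).posApply (p.φ 1) * ((Φ⁻¹ : Aˣ) * p.φ i) := by
  have h := congrArg (fun P : PDO d => P.posApply (p.φ i)) (pos_conj_mul_darboux hL p)
  simp only [posApply_add, posApply_C, (isDiff_pos _).posApply_mul (isDiff_darboux Φ),
    (isDiff_darboux Φ).posApply_mul (isDiff_pos _), posApply_pos] at h
  rw [h, p.φ_succ, posApply_add_right, posApply_darboux_mul, posApply_darboux_self, p.deriv_S,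
    p.ψ_zero]
  ring

theorem concomitant_zero_right (P : PDO d) (f : A) : P.concomitant f 0 = 0 := by
  rw [concomitant_eq, map_zero, mul_zero, zero_mul, posApply_zero]

/-- `(L'*)ʲ(Ψ')` for the Darboux-Bäcklund transform, that is `-Φ⁻¹ ∂ₓ⁻¹(Φ (L*)ʲ⁻¹(Ψ))`. -/
def darbouxψ (p : NonlocalAction L Φ Ψ) : ℕ → A
  | 0 => (Φ⁻¹ : Aˣ)
  | j + 1 => -((Φ⁻¹ : Aˣ) * p.S 0 j)

/-- The antiderivatives belonging to the Darboux-Bäcklund transform. -/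
def darbouxS (p : NonlocalAction L Φ Ψ) (i : ℕ) : ℕ → A
  | 0 => (Φ⁻¹ : Aˣ) * p.φ (i + 1)
  | j + 1 => p.S (i + 1) j - (Φ⁻¹ : Aˣ) * p.φ (i + 1) * p.S 0 j

theorem posAdjApply_conj_zero (hL : L.neg = C d Φ * ((D d)⁻¹ : (PDO d)ˣ) * C d Ψ)
    (p : NonlocalAction L Φ Ψ) : (conj Φ L).posAdjApply (darbouxψ p 0) =
      (Φ⁻¹ : Aˣ) * ((Φ⁻¹ : Aˣ) * L.posApply Φ) := by
  rw [← posAdjApply_pos, posAdjApply_of_mul_darboux Φ (isDiff_pos _) (pos_conj_mul_darboux hL p),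
    concomitant_darboux_mul, darbouxψ, Units.mul_inv, d.map_one_eq_zero, mul_zero, neg_zero,
    concomitant_zero_right, add_zero]

theorem neg_inv_mul_deriv_darbouxψ (p : NonlocalAction L Φ Ψ) (j : ℕ) :
    -((Φ⁻¹ : Aˣ) * d (Φ * darbouxψ p (j + 1))) = p.ψ j := by
  rw [darbouxψ, mul_neg, ← mul_assoc, Units.mul_inv, one_mul, map_neg, p.deriv_S, p.φ_zero,
    mul_neg, neg_neg, ← mul_assoc, Units.inv_mul, one_mul]

theorem posAdjApply_conj_succ (hL : L.neg = C d Φ * ((D d)⁻¹ : (PDO d)ˣ) * C d Ψ)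
    (p : NonlocalAction L Φ Ψ) (j : ℕ) : (conj Φ L).posAdjApply (darbouxψ p (j + 1)) =
      (Φ⁻¹ : Aˣ) * (L.concomitant Φ (p.ψ j) - (Φ⁻¹ : Aˣ) * p.S 0 j * L.posApply Φ) := by
  rw [← posAdjApply_pos, posAdjApply_of_mul_darboux Φ (isDiff_pos _) (pos_conj_mul_darboux hL p),
    concomitant_darboux_mul, neg_inv_mul_deriv_darbouxψ, darbouxψ]
  ring

/-- The nonlocal functions of the Darboux-Bäcklund transform. -/
noncomputable def NonlocalAction.darboux (hL : L.neg = C d Φ * ((D d)⁻¹ : (PDO d)ˣ) * C d Ψ)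
    (p : NonlocalAction L Φ Ψ) :
    NonlocalAction (conj Φ L) ((CKP.darboux d Φ : PDO d).posApply (p.φ 1)) (Φ⁻¹ : Aˣ) where
  φ i := (CKP.darboux d Φ : PDO d).posApply (p.φ (i + 1))
  ψ := darbouxψ p
  S := darbouxS p
  deriv_S i j := by
    rcases j with _ | j
    · rw [darbouxS, darbouxψ, posApply_darboux, mul_comm (Φ : A), mul_assoc, Units.mul_inv,
        mul_one]
    · rw [darbouxS, darbouxψ, posApply_darboux, map_sub, d.leibniz, p.deriv_S, p.deriv_S,
        smul_eq_mul, smul_eq_mul, p.φ_zero]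
      linear_combination (d ((Φ⁻¹ : Aˣ) * p.φ (i + 1)) * p.S 0 j -
        p.φ (i + 1) * p.ψ j) * Φ.mul_inv
  φ_zero := rfl
  φ_succ i := posApply_pos_conj hL p (i + 1)
  ψ_zero := rfl
  ψ_succ j := by
    have h0 := p.φ_succ 0
    rw [p.φ_zero, zero_add] at h0
    rcases j with _ | j
    · rw [posAdjApply_conj_zero hL, darbouxψ, darbouxS, zero_add, h0]
      -- L₊(Φ) cancels between the adjoint of L̃₊ and the antiderivative Φ⁻¹ φ 1; only -Φ⁻¹ S 0 0 is
      -- left.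
      linear_combination ((Φ⁻¹ : Aˣ) * p.S 0 0) * Φ.inv_mul
    -- The concomitant of L₊ at Φ and ψ j is eliminated by the integration-by-parts rule for L
    -- itself.
    · have h1 := p.by_parts 0 j
      rw [p.φ_zero] at h1
      rw [posAdjApply_conj_succ hL, darbouxψ, darbouxS]
      rw [zero_add] at h1 ⊢
      rw [h0]
      linear_combination ((Φ⁻¹ : Aˣ) : A) * h1 +
        (-(Φ⁻¹ : Aˣ) * p.S 0 0 * p.S 0 j) * Φ.inv_mul
  by_parts i j := by
    have h0 := p.φ_succ 0
    rw [p.φ_zero, zero_add] at h0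
    have hi := p.φ_succ (i + 1)
    rw [← concomitant_pos, concomitant_of_mul_darboux Φ (isDiff_pos _)
      (pos_conj_mul_darboux hL p), concomitant_darboux_mul, posAdjApply_pos]
    rcases j with _ | j
    · rw [posAdjApply_conj_zero hL, darbouxψ, Units.mul_inv, d.map_one_eq_zero, mul_zero, neg_zero,
        concomitant_zero_right]
      simp only [darbouxS, zero_add]
      rw [h0, hi]
      linear_combination (p.S (i + 1) 0 - (Φ⁻¹ : Aˣ) * p.φ (i + 1) * p.S 0 0) * Φ.inv_mul
    · have h1 := p.by_parts 0 j
      rw [p.φ_zero, zero_add] at h1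
      have h2 := p.by_parts (i + 1) j
      rw [posAdjApply_conj_succ hL, neg_inv_mul_deriv_darbouxψ]
      simp only [darbouxS, darbouxψ, zero_add]
      rw [h0, hi]
      linear_combination h2 - p.φ (i + 1) * (Φ⁻¹ : Aˣ) * h1 +
        ((Φ⁻¹ : Aˣ) * p.φ (i + 1) * p.S 0 j * p.S 0 0 - p.S (i + 1) 0 * p.S 0 j) * Φ.inv_mul

/-- `by_parts`, solved for S i (j+1), is a recursion in j. -/
theorem NonlocalAction.eq_of_S_eq {L : PDO d} {Φ Ψ : A} (p q : NonlocalAction L Φ Ψ)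
    (h : ∀ i, p.S i 0 = q.S i 0) : p.φ = q.φ ∧ p.ψ = q.ψ ∧ p.S = q.S := by
  have hφ : ∀ i, p.φ i = q.φ i := by
    intro i
    induction i with
    | zero => rw [p.φ_zero, q.φ_zero]
    | succ i ih => rw [p.φ_succ, q.φ_succ, ih, h]
  have hψ : ∀ j, p.ψ j = q.ψ j ∧ ∀ i, p.S i j = q.S i j := by
    intro j
    induction j with
    | zero => exact ⟨by rw [p.ψ_zero, q.ψ_zero], h⟩
    | succ j ih =>
      refine ⟨by rw [p.ψ_succ, q.ψ_succ, ih.1, ih.2], fun i => ?_⟩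
      have h1 := p.by_parts i j
      have h2 := q.by_parts i j
      rw [hφ, ih.1, ih.2, ih.2, h] at h1
      linear_combination h2 - h1
  exact ⟨funext hφ, funext fun j => (hψ j).1, funext fun i => funext fun j => (hψ j).2 i⟩

/-- The pseudo-differential part of `Lⁿ`, and the action of `Lⁿ` on `Lⁱ(Φ)`. -/
theorem neg_pow_and_posApply_pow {L : PDO d} {Φ Ψ : A}
    (hL : L.neg = C d Φ * ((D d)⁻¹ : (PDO d)ˣ) * C d Ψ) (p : NonlocalAction L Φ Ψ) (n : ℕ) :
    (L ^ n).neg = ∑ j ∈ Finset.range n,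
        C d (p.φ (n - 1 - j)) * ((D d)⁻¹ : (PDO d)ˣ) * C d (p.ψ j) ∧
      ∀ i, (L ^ n).posApply (p.φ i) + ∑ j ∈ Finset.range n, p.φ (n - 1 - j) * p.S i j =
        p.φ (n + i) := by
  induction n with
  | zero =>
    refine ⟨?_, fun i => ?_⟩
    · rw [pow_zero, Finset.range_zero, Finset.sum_empty, ← map_one (C d), (isDiff_C _).neg_eq]
    · rw [pow_zero, Finset.range_zero, Finset.sum_empty, ← map_one (C d), posApply_C, one_mul,
        add_zero, zero_add]
  | succ n ih =>
    obtain ⟨ih1, ih2⟩ := ih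
    -- The reason for proving both statements at once: (Lⁿ)₊(Φ), the remainder in (Lⁿ)₊L₋, combines
    -- with the sum over S 0 j produced by (Lⁿ)₋L₋ to φ n.
    have hΦ := ih2 0
    rw [add_zero, p.φ_zero] at hΦ
    have hsplit : L ^ (n + 1) = (L ^ n).pos * L.pos + (L ^ n).pos * L.neg +
        (L ^ n).neg * L.pos + (L ^ n).neg * L.neg := by
      conv_lhs => rw [pow_succ, ← pos_add_neg (L ^ n), ← pos_add_neg L, _root_.mul_add,
        _root_.add_mul, _root_.add_mul]
      simp only [pos_add_neg]
      abel
    have hd := isDiff_pos (L ^ n)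
    have hlast : ∀ F : ℕ → ℕ → PDO d, ∑ j ∈ Finset.range (n + 1), F (n + 1 - 1 - j) j =
        ∑ j ∈ Finset.range n, F (n - 1 - j) (j + 1) + F n 0 := by
      intro F
      rw [Finset.sum_range_succ']
      congr 1
      exact Finset.sum_congr rfl fun j _ => by congr 1; omega
    have hlast' : ∀ F : ℕ → ℕ → A, ∑ j ∈ Finset.range (n + 1), F (n + 1 - 1 - j) j =
        ∑ j ∈ Finset.range n, F (n - 1 - j) (j + 1) + F n 0 := by
      intro F
      rw [Finset.sum_range_succ']
      congr 1
      exact Finset.sum_congr rfl fun j _ => by congr 1; omega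
    refine ⟨?_, fun i => ?_⟩
    · have h1 : ((L ^ n).pos * L.neg).neg =
          C d ((L ^ n).posApply Φ) * ((D d)⁻¹ : (PDO d)ˣ) * C d Ψ := by
        rw [hL, ← mul_assoc, ← mul_assoc, neg_mul_C, hd.neg_mul_C_mul_inv_D, posApply_pos]
      have h2 : ((L ^ n).neg * L.pos).neg = ∑ j ∈ Finset.range n, C d (p.φ (n - 1 - j)) *
          (((D d)⁻¹ : (PDO d)ˣ) * C d (L.posAdjApply (p.ψ j))) := by
        rw [ih1, Finset.sum_mul, neg_sum]
        refine Finset.sum_congr rfl fun j _ => ?_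
        rw [mul_assoc, mul_assoc, neg_C_mul, ← mul_assoc, (isDiff_pos L).neg_inv_D_mul_C_mul,
          posAdjApply_pos]
      have h3 : ((L ^ n).neg * L.neg).neg = ∑ j ∈ Finset.range n, C d (p.φ (n - 1 - j)) *
          (C d (p.S 0 j) * ((D d)⁻¹ : (PDO d)ˣ) * C d Ψ -
            ((D d)⁻¹ : (PDO d)ˣ) * C d (Ψ * p.S 0 j)) := by
        rw [((isNeg_neg _).mul (isNeg_neg _)).neg_eq, ih1, Finset.sum_mul]
        refine Finset.sum_congr rfl fun j _ => ?_
        have h : C d (p.ψ j) * C d Φ = C d (d (p.S 0 j)) := by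
          rw [p.deriv_S, p.φ_zero, mul_comm, map_mul]
        rw [hL, mul_comm Ψ, map_mul (C d) (p.S 0 j)]
        calc _ = C d (p.φ (n - 1 - j)) * (((D d)⁻¹ : (PDO d)ˣ) * (C d (p.ψ j) * C d Φ) *
              ((D d)⁻¹ : (PDO d)ˣ)) * C d Ψ := by simp only [mul_assoc]
          _ = _ := by rw [h, inv_D_mul_C_deriv]; noncomm_ring
      rw [hsplit, neg_part_add, neg_part_add, neg_part_add, (hd.mul (isDiff_pos L)).neg_eq, h1, h2, h3,
        hlast fun a b => C d (p.φ a) * ((D d)⁻¹ : (PDO d)ˣ) * C d (p.ψ b), ← hΦ, p.ψ_zero, map_add,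
        map_sum, _root_.add_mul, _root_.add_mul, Finset.sum_mul, Finset.sum_mul, zero_add,
        add_assoc, add_comm, ← Finset.sum_add_distrib, add_comm (C d _ * _ * _), ← add_assoc,
        ← Finset.sum_add_distrib]
      congr 1
      refine Finset.sum_congr rfl fun j _ => ?_
      rw [p.ψ_succ, map_sub, map_mul (C d) (p.φ _)]
      noncomm_ring
    · have h1 : ((L ^ n).pos * L.neg).posApply (p.φ i) =
          (L ^ n).posApply (Φ * p.S i 0) - (L ^ n).posApply Φ * p.S i 0 := by
        rw [hL, posApply_mul_neg hd Φ Ψ (p.φ i) (p.S i 0)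
          (by rw [p.deriv_S, p.ψ_zero, mul_comm]), posApply_pos, posApply_pos]
      have h2 : ((L ^ n).neg * L.pos).posApply (p.φ i) = ∑ j ∈ Finset.range n, p.φ (n - 1 - j) *
          L.concomitant (p.φ i) (p.ψ j) := by
        rw [ih1, Finset.sum_mul, posApply_sum]
        refine Finset.sum_congr rfl fun j _ => ?_
        rw [concomitant_eq, mul_assoc, mul_assoc, ← posApply_pos, pos_C_mul,
          (isDiff_C _).posApply_mul (isDiff_pos _), posApply_C, posApply_pos, mul_assoc]
      have h3 : ((L ^ n).neg * L.neg).posApply (p.φ i) = 0 :=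
        ((isNeg_neg _).mul (isNeg_neg _)).posApply_eq _
      -- The action of Lⁿ on φ (i+1) = L(φ i); `by_parts` then trades each S (i+1) j for S i (j+1),
      -- a concomitant and a product.
      have h4 := ih2 (i + 1)
      rw [p.φ_succ, posApply_add_right] at h4
      have h5 : ∑ j ∈ Finset.range n, p.φ (n - 1 - j) * p.S (i + 1) j =
          ∑ j ∈ Finset.range n, p.φ (n - 1 - j) * L.concomitant (p.φ i) (p.ψ j) +
          ∑ j ∈ Finset.range n, p.φ (n - 1 - j) * p.S i (j + 1) +
          (∑ j ∈ Finset.range n, p.φ (n - 1 - j) * p.S 0 j) * p.S i 0 := by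
        rw [Finset.sum_mul, ← Finset.sum_add_distrib, ← Finset.sum_add_distrib]
        refine Finset.sum_congr rfl fun j _ => ?_
        linear_combination p.φ (n - 1 - j) * p.by_parts i j
      rw [hsplit, posApply_add, posApply_add, posApply_add, h1, h2, h3,
        hd.posApply_mul (isDiff_pos L), posApply_pos, posApply_pos,
        hlast' fun a b => p.φ a * p.S i b, show n + 1 + i = n + (i + 1) by ring]
      linear_combination h4 - h5 - p.S i 0 * hΦ

end Nonlocal

end CKP

/-! ### Coefficientwise derivations of operators -/

namespace PDO

variable {A : Type*} [CommRing A] {d : Derivation ℤ A A}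

theorem coeff_mapCoeff (δ : Derivation ℤ A A) (P : PDO d) (i : ℤ) :
    (mapCoeff δ P).coeff i = δ (P.coeff i) := rfl

theorem mapCoeff_C (δ : Derivation ℤ A A) (a : A) : mapCoeff δ (C d a) = C d (δ a) := by
  ext i
  rw [coeff_mapCoeff, coeff_C, coeff_C]
  split_ifs <;> simp

theorem mapCoeff_powD (δ : Derivation ℤ A A) (j : ℤ) : mapCoeff δ (powD d j) = 0 := by
  ext i
  rw [coeff_mapCoeff, coeff_powD]
  split_ifs <;> simp

theorem mapCoeff_inv_D (δ : Derivation ℤ A A) :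
    mapCoeff δ (((D d)⁻¹ : (PDO d)ˣ) : PDO d) = 0 :=
  mapCoeff_powD δ (-1)

theorem mapCoeff_neg_part (δ : Derivation ℤ A A) (P : PDO d) :
    mapCoeff δ P.neg = (mapCoeff δ P).neg := by
  ext i
  rw [coeff_mapCoeff, coeff_neg_part, coeff_neg_part, coeff_mapCoeff]
  split_ifs <;> simp

/-- The Leibniz rule for a derivation that commutes with `d`. -/
theorem mapCoeff_mul {δ : Derivation ℤ A A} (hδ : ∀ a, δ (d a) = d (δ a)) (P Q : PDO d) :
    mapCoeff δ (P * Q) = mapCoeff δ P * Q + P * mapCoeff δ Q := by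
  have hit : ∀ m a, δ (d^[m] a) = d^[m] (δ a) := by
    intro m a
    induction m with
    | zero => rfl
    | succ m ih => rw [Function.iterate_succ_apply', Function.iterate_succ_apply', hδ, ih]
  ext n
  obtain ⟨N, hN⟩ := Q.bdd
  obtain ⟨M, hnM, hM⟩ := P.exists_bound (n - N)
  obtain ⟨k, rfl⟩ : ∃ k : ℕ, n = M + N - k := ⟨(M + N - n).toNat, by omega⟩
  have hM' : ∀ i, M < i → (mapCoeff δ P).coeff i = 0 := fun i hi => by
    rw [coeff_mapCoeff, hM i hi, map_zero]
  have hN' : ∀ i, N < i → (mapCoeff δ Q).coeff i = 0 := fun i hi => by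
    rw [coeff_mapCoeff, hN i hi, map_zero]
  rw [coeff_mapCoeff, coeff_add, coeff_mul_eq P Q M N hM hN, coeff_mul_eq _ Q M N hM' hN,
    coeff_mul_eq P _ M N hM hN', map_sum, ← Finset.sum_add_distrib]
  refine Finset.sum_congr rfl fun p _ => ?_
  rw [map_sum, ← Finset.sum_add_distrib]
  refine Finset.sum_congr rfl fun q _ => ?_
  rw [map_zsmul, δ.leibniz, hit, coeff_mapCoeff, coeff_mapCoeff, ← smul_add, smul_eq_mul,
    smul_eq_mul]
  congr 1
  ring

theorem mapCoeff_one (δ : Derivation ℤ A A) : mapCoeff δ (1 : PDO d) = 0 :=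
  mapCoeff_powD δ 0

theorem mapCoeff_inv {δ : Derivation ℤ A A} (hδ : ∀ a, δ (d a) = d (δ a)) (W : (PDO d)ˣ) :
    mapCoeff δ ((W⁻¹ : (PDO d)ˣ) : PDO d) =
      -((W⁻¹ : (PDO d)ˣ) * mapCoeff δ (W : PDO d) * (W⁻¹ : (PDO d)ˣ)) := by
  have h := mapCoeff_mul hδ ((W⁻¹ : (PDO d)ˣ) : PDO d) W
  rw [Units.inv_mul, mapCoeff_one, eq_comm, ← eq_neg_iff_add_eq_zero] at h
  rw [← neg_mul, Units.eq_mul_inv_iff_mul_eq, h]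

theorem concomitant_sub (P Q : PDO d) (f g : A) :
    (P - Q).concomitant f g = P.concomitant f g - Q.concomitant f g := by
  rw [eq_sub_iff_add_eq, ← concomitant_add, sub_add_cancel]

end PDO

namespace CKP

open PDO

variable {A : Type*} [CommRing A] {d : Derivation ℤ A A}

/-! ### Preservation of the hierarchy -/

theorem deriv_inv_unit (δ : Derivation ℤ A A) (Φ : Aˣ) :
    δ ((Φ⁻¹ : Aˣ) : A) = -((Φ⁻¹ : Aˣ) * (Φ⁻¹ : Aˣ) * δ Φ) := by
  rw [δ.leibniz_of_mul_eq_one Φ.inv_mul, smul_eq_mul]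
  ring

theorem mapCoeff_darboux {δ : Derivation ℤ A A} (hδ : ∀ a, δ (d a) = d (δ a)) (Φ : Aˣ) :
    mapCoeff δ (darboux d Φ : PDO d) = darbouxVar d Φ (δ Φ) := by
  rw [val_darboux, mapCoeff_mul hδ, mapCoeff_mul hδ, mapCoeff_C, mapCoeff_C, val_D, mapCoeff_powD,
    deriv_inv_unit, map_neg, darbouxVar, val_D]
  noncomm_ring

theorem dressed_mul (W : (PDO d)ˣ) (l m : ℕ) : dressed W l * dressed W m = dressed W (l + m) := by
  simp only [dressed, mul_assoc, Units.inv_mul_cancel_left, pow_add]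

theorem dressed_pow (W : (PDO d)ˣ) (r n : ℕ) : dressed W r ^ n = dressed W (r * n) := by
  induction n with
  | zero => simp [dressed]
  | succ n ih => rw [pow_succ, ih, dressed_mul, Nat.mul_succ]

theorem mapCoeff_pow_D (δ : Derivation ℤ A A) (hδ : ∀ a, δ (d a) = d (δ a)) (l : ℕ) :
    mapCoeff δ ((D d : PDO d) ^ l) = 0 := by
  induction l with
  | zero => rw [pow_zero, mapCoeff_one]
  | succ l ih => rw [pow_succ, mapCoeff_mul hδ, ih, val_D, mapCoeff_powD, zero_mul, mul_zero,
      add_zero]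

/-- The Lax equation follows from the Wilson-Sato equation. -/
theorem mapCoeff_dressed {δ : Derivation ℤ A A} (hδ : ∀ a, δ (d a) = d (δ a)) (W : (PDO d)ˣ)
    (l r : ℕ) (h : mapCoeff δ (W : PDO d) = -(dressed W l).neg * W) :
    mapCoeff δ (dressed W r) = comm (dressed W l).pos (dressed W r) := by
  have hc : dressed W l * dressed W r = dressed W r * dressed W l := by
    rw [dressed_mul, dressed_mul, add_comm]
  have h1 : mapCoeff δ (dressed W r) =
      -(dressed W l).neg * dressed W r + dressed W r * (dressed W l).neg := by
    conv_lhs => rw [dressed]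
    rw [mapCoeff_mul hδ, mapCoeff_mul hδ, mapCoeff_pow_D δ hδ, mapCoeff_inv hδ, h, mul_zero,
      add_zero]
    have h2 : ∀ P Q : PDO d, P * ((W⁻¹ : (PDO d)ˣ) * (-Q * W) * (W⁻¹ : (PDO d)ˣ)) =
        -(P * (W⁻¹ : (PDO d)ˣ) * Q) := by
      intro P Q
      simp only [mul_assoc, neg_mul, mul_neg, Units.mul_inv, mul_one]
    rw [mul_neg, h2, neg_neg]
    simp only [dressed, mul_assoc]
  have h3 : (dressed W l).pos = dressed W l - (dressed W l).neg :=
    eq_sub_of_add_eq (pos_add_neg _)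
  rw [h1, PDO.comm, h3, sub_mul, mul_sub, hc, neg_mul]
  abel

/-- The right factor D⁻¹ of W̃ commutes with Dˡ, so it does not affect the dressed operators; it
only brings the order of W̃ back to zero. -/
theorem dressed_darboux (Φ : Aˣ) (W : (PDO d)ˣ) (l : ℕ) :
    dressed (darboux d Φ * W * (D d)⁻¹) l = conj Φ (dressed W l) := by
  have h : (((D d)⁻¹ : (PDO d)ˣ) : PDO d) * ((D d : PDO d) ^ l * D d) = (D d : PDO d) ^ l := by
    rw [← pow_succ, pow_succ', inv_D_mul_D_mul]
  rw [dressed, dressed, conj, mul_inv_rev, mul_inv_rev, inv_inv]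
  simp only [Units.val_mul]
  calc _ = (darboux d Φ : PDO d) * W * (((D d)⁻¹ : (PDO d)ˣ) * ((D d : PDO d) ^ l * D d)) *
      (W⁻¹ : (PDO d)ˣ) * ((darboux d Φ)⁻¹ : (PDO d)ˣ) := by simp only [mul_assoc]
    _ = _ := by rw [h]; simp only [mul_assoc]

/-- The variation of `T` is `B' T - T B`, for `B = P₊` and `B' = (T P T⁻¹)₊`. -/
theorem pos_conj_mul_darboux_eq (Φ : Aˣ) (P : PDO d) :
    (conj Φ P).pos * darboux d Φ = darboux d Φ * P.pos + darbouxVar d Φ (P.posApply (Φ : A)) := by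
  have h : (conj Φ P).pos = conj Φ P.pos +
      darbouxVar d Φ (P.posApply (Φ : A)) * ((darboux d Φ)⁻¹ : (PDO d)ˣ) := by
    have h1 : (conj Φ P).pos + (conj Φ P).neg = conj Φ P.pos + conj Φ P.neg := by
      rw [pos_add_neg, ← conj_add, pos_add_neg]
    rw [eq_sub_of_add_eq h1, neg_conj, darbouxVar_mul_inv]
    abel
  rw [h, _root_.add_mul, conj_mul_darboux, Units.inv_mul_cancel_right]

/-- The left side is Φ⁻¹ times the concomitant of TP₊ + δT at Φ and Φ⁻¹. There T*(Φ⁻¹) = 0, and the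
two halves of δT cancel. This yields the adjoint eigenfunction equation for Φ⁻¹. -/
theorem posAdjApply_conj_inv (Φ : Aˣ) (P : PDO d) :
    (conj Φ P).posAdjApply ((Φ⁻¹ : Aˣ) : A) = (Φ⁻¹ : Aˣ) * (Φ⁻¹ : Aˣ) * P.posApply (Φ : A) := by
  rw [← posAdjApply_pos, posAdjApply_of_mul_darboux Φ (isDiff_pos _) (pos_conj_mul_darboux_eq Φ P),
    concomitant_add, (isDiff_darboux Φ).concomitant_mul (isDiff_pos P), concomitant_darboux,
    posAdjApply_darboux, Units.mul_inv, d.map_one_eq_zero, mul_zero, neg_zero,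
    concomitant_zero_right, darbouxVar, concomitant_sub, concomitant_C_mul_D_mul_C,
    concomitant_C_mul_D_mul_C, posApply_pos]
  linear_combination (-((Φ⁻¹ : Aˣ) : A) ^ 3 * Φ * P.posApply (Φ : A)) * Φ.inv_mul

theorem neg_comm_of_isDiff {B L : PDO d} {f g : A} (hB : B.IsDiff)
    (hL : L.neg = C d f * ((D d)⁻¹ : (PDO d)ˣ) * C d g) :
    (comm B L).neg = C d (B.posApply f) * ((D d)⁻¹ : (PDO d)ˣ) * C d g -
      C d f * ((D d)⁻¹ : (PDO d)ˣ) * C d (B.posAdjApply g) := by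
  have h1 : (B * L).neg = C d (B.posApply f) * ((D d)⁻¹ : (PDO d)ˣ) * C d g := by
    rw [← pos_add_neg L, _root_.mul_add, neg_part_add, (hB.mul (isDiff_pos L)).neg_eq, zero_add,
      hL, ← mul_assoc, ← mul_assoc, neg_mul_C, hB.neg_mul_C_mul_inv_D]
  have h2 : (L * B).neg = C d f * ((D d)⁻¹ : (PDO d)ˣ) * C d (B.posAdjApply g) := by
    rw [← pos_add_neg L, _root_.add_mul, neg_part_add, ((isDiff_pos L).mul hB).neg_eq, zero_add,
      hL, mul_assoc, mul_assoc, neg_C_mul, ← mul_assoc, hB.neg_inv_D_mul_C_mul, mul_assoc]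
  rw [PDO.comm, neg_part_sub, h1, h2]

/-- An invertible adjoint eigenfunction forces its partner to be an eigenfunction. -/
theorem eigenfunction_of_adjoint {δ : Derivation ℤ A A} (hδ : ∀ a, δ (d a) = d (δ a))
    {B L : PDO d} {f : A} {g : Aˣ} (hB : B.IsDiff)
    (hL : L.neg = C d f * ((D d)⁻¹ : (PDO d)ˣ) * C d g) (hlax : mapCoeff δ L = comm B L)
    (hg : δ (g : A) = -B.posAdjApply (g : A)) : δ f = B.posApply f := by
  -- The negative part of the Lax equation reads δf D⁻¹ g + f D⁻¹ δg = B(f) D⁻¹ g - f D⁻¹ B*(g). The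
  -- terms with f on the left cancel, and right multiplication by g⁻¹D isolates δf.
  have h := congrArg PDO.neg hlax
  rw [neg_comm_of_isDiff hB hL, ← mapCoeff_neg_part, hL, mapCoeff_mul hδ, mapCoeff_mul hδ,
    mapCoeff_C, mapCoeff_C, mapCoeff_inv_D, mul_zero, add_zero, hg, map_neg, mul_neg,
    ← sub_eq_add_neg, sub_left_inj] at h
  have h1 := congrArg (fun P : PDO d => (P * C d (g⁻¹ : Aˣ) * D d).coeff 0) h
  simpa only [mul_assoc, ← map_mul, Units.mul_inv_cancel_left, ← _root_.map_mul (C d),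
    Units.mul_inv, map_one, one_mul, mul_one, Units.inv_mul, coeff_C, if_true] using h1

theorem isCKP_darboux {dt : ℕ+ → Derivation ℤ A A} (hcomm : ∀ l m a, dt l (dt m a) = dt m (dt l a))
    {r : ℕ} {W : (PDO (dt 1))ˣ} {Φ : Aˣ} {Ψ : A} (hW : IsCKP dt r W Φ Ψ)
    (p : NonlocalAction (dressed W r) Φ Ψ) :
    IsCKP dt r (darboux (dt 1) Φ * W * (D (dt 1))⁻¹)
      ((darboux (dt 1) Φ : PDO (dt 1)).posApply (p.φ 1)) (Φ⁻¹ : Aˣ) := by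
  have hcoeff : ∀ i, ((darboux (dt 1) Φ * W * (D (dt 1))⁻¹ : (PDO (dt 1))ˣ) : PDO (dt 1)).coeff i =
      Φ * ((Φ⁻¹ : Aˣ) * (W : PDO (dt 1)).coeff i +
        dt 1 ((Φ⁻¹ : Aˣ) * (W : PDO (dt 1)).coeff (i + 1))) := by
    intro i
    rw [Units.val_mul, Units.val_mul, coeff_mul_inv_D, val_darboux, mul_assoc, mul_assoc,
      coeff_C_mul, coeff_D_mul, coeff_C_mul, coeff_C_mul, add_sub_cancel_right]
  have hsato : ∀ l : ℕ+, mapCoeff (dt l)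
      ((darboux (dt 1) Φ * W * (D (dt 1))⁻¹ : (PDO (dt 1))ˣ) : PDO (dt 1)) =
      -(dressed (darboux (dt 1) Φ * W * (D (dt 1))⁻¹) l).neg *
        ((darboux (dt 1) Φ * W * (D (dt 1))⁻¹ : (PDO (dt 1))ˣ) : PDO (dt 1)) := by
    intro l
    have hδ := hcomm l 1
    -- Moved to the form δT = -(T(φ) D⁻¹ Φ⁻¹) T, this is the correction term of `neg_conj` acting on
    -- W̃.
    have hv := darbouxVar_mul_inv (d := dt 1) Φ ((dressed W l).posApply (Φ : A))
    rw [eq_comm, Units.eq_mul_inv_iff_mul_eq] at hv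
    rw [dressed_darboux, neg_conj, Units.val_mul, Units.val_mul, mapCoeff_mul hδ, mapCoeff_mul hδ,
      mapCoeff_darboux hδ, hW.sato, hW.eigenfunction, mapCoeff_inv_D, ← hv, conj]
    simp only [neg_add, _root_.add_mul, neg_mul, mul_neg, mul_zero, add_zero, mul_assoc,
      Units.inv_mul_cancel_left]
    abel
  have hneg : (conj Φ (dressed W r)).neg = _ := neg_conj_lax hW.constraint p
  have hadj : ∀ l : ℕ+, dt l ((Φ⁻¹ : Aˣ) : A) =
      -(conj Φ (dressed W l)).posAdjApply ((Φ⁻¹ : Aˣ) : A) := fun l => by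
    rw [posAdjApply_conj_inv, deriv_inv_unit, hW.eigenfunction]
  refine ⟨?_, fun i hi => ?_, hsato, ?_, fun l => ?_, fun l => ?_⟩
  · rw [hcoeff, hW.coeff_zero, hW.coeff_pos _ (by norm_num), mul_zero, map_zero, add_zero, mul_one,
      Units.mul_inv]
  · rw [hcoeff, hW.coeff_pos i hi, hW.coeff_pos _ (by omega), mul_zero, map_zero, add_zero,
      mul_zero]
  · rw [dressed_darboux, hneg]
  -- The equation for Φ̃ needs no direct computation: Ψ̃ = Φ⁻¹ is invertible, so it follows from the
  -- Lax equation and the equation for Ψ̃.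
  · have hlax := mapCoeff_dressed (hcomm l 1) _ l r (hsato l)
    rw [dressed_darboux, dressed_darboux] at hlax
    have h := eigenfunction_of_adjoint (B := (conj Φ (dressed W l)).pos) (g := Φ⁻¹) (hcomm l 1)
      (isDiff_pos _) hneg hlax (by rw [posAdjApply_pos, hadj])
    rw [dressed_darboux, h, posApply_pos]
  · rw [dressed_darboux, hadj]

/-! ### First-order variations -/

section Extension

variable {B : Type*} [CommRing B] {e : Derivation ℤ B B}

/-- The operator `P + ε X` for a model `F` of the dual numbers `a + ε b`. -/
def extOp (F : A × A →+ B) (P X : PDO d) : PDO e :=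
  ⟨fun i => F (P.coeff i, X.coeff i), by
    obtain ⟨N, hP, hX⟩ := exists_common_bound P X
    exact ⟨N, fun i hi => by rw [hP i hi, hX i hi, ← Prod.zero_eq_mk, map_zero]⟩⟩

theorem coeff_extOp (F : A × A →+ B) (P X : PDO d) (i : ℤ) :
    (extOp F P X : PDO e).coeff i = F (P.coeff i, X.coeff i) := rfl

variable {F : A × A →+ B}

theorem extOp_C (a b : A) : (extOp F (C d a) (C d b) : PDO e) = C e (F (a, b)) := by
  ext i
  rw [coeff_extOp, coeff_C, coeff_C, coeff_C]
  split_ifs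
  · rfl
  · rw [← Prod.zero_eq_mk, map_zero]

theorem extOp_powD (h1 : F (1, 0) = 1) (j : ℤ) :
    (extOp F (powD d j) 0 : PDO e) = powD e j := by
  ext i
  rw [coeff_extOp, coeff_powD, coeff_powD, coeff_zero]
  split_ifs
  · exact h1
  · rw [← Prod.zero_eq_mk, map_zero]

/-- The product of operators uses only sums, products and the derivation of the coefficients, so
these rules for F (with ε² = 0 and dε = 0) suffice. -/
theorem extOp_mul (hmul : ∀ x y, F x * F y = F (x.1 * y.1, x.1 * y.2 + x.2 * y.1))
    (hd : ∀ x, e (F x) = F (d x.1, d x.2)) (P X Q Y : PDO d) :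
    (extOp F P X * extOp F Q Y : PDO e) = extOp F (P * Q) (P * Y + X * Q) := by
  have hit : ∀ (m : ℕ) (x : A × A), e^[m] (F x) = F (d^[m] x.1, d^[m] x.2) := by
    intro m x
    induction m with
    | zero => rfl
    | succ m ih => rw [Function.iterate_succ_apply', ih, hd, Function.iterate_succ_apply',
        Function.iterate_succ_apply']
  have hsum : ∀ {ι : Type} (s : Finset ι) (f g : ι → A),
      F (∑ j ∈ s, f j, ∑ j ∈ s, g j) = ∑ j ∈ s, F (f j, g j) := by
    intro ι s f g
    rw [← map_sum]
    exact congrArg F (Prod.ext (by rw [Prod.fst_sum]) (by rw [Prod.snd_sum]))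
  ext n
  obtain ⟨N, hQ, hY⟩ := exists_common_bound Q Y
  obtain ⟨K, hP, hX⟩ := exists_common_bound P X
  obtain ⟨M, hK, hM⟩ : ∃ M, K ≤ M ∧ n - N ≤ M := ⟨max K (n - N), le_max_left _ _, le_max_right _ _⟩
  replace hP : ∀ i, M < i → P.coeff i = 0 := fun i hi => hP i (by omega)
  replace hX : ∀ i, M < i → X.coeff i = 0 := fun i hi => hX i (by omega)
  obtain ⟨k, rfl⟩ : ∃ k : ℕ, n = M + N - k := ⟨(M + N - n).toNat, by omega⟩
  rw [coeff_mul_eq _ _ M N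
    (fun i hi => by rw [coeff_extOp, hP i hi, hX i hi, ← Prod.zero_eq_mk, map_zero])
    (fun i hi => by rw [coeff_extOp, hQ i hi, hY i hi, ← Prod.zero_eq_mk, map_zero]), coeff_extOp,
    coeff_add, coeff_mul_eq P Q M N hP hQ, coeff_mul_eq P Y M N hP hY, coeff_mul_eq X Q M N hX hQ,
    ← Finset.sum_add_distrib, hsum]
  refine Finset.sum_congr rfl fun p _ => ?_
  rw [← Finset.sum_add_distrib, hsum]
  refine Finset.sum_congr rfl fun q _ => ?_
  rw [coeff_extOp, coeff_extOp, hit, hmul, ← map_zsmul, Prod.smul_mk, smul_add]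

/-- The first-order expansion of `T L T⁻¹`. -/
theorem conj_extOp (h1 : F (1, 0) = 1)
    (hmul : ∀ x y, F x * F y = F (x.1 * y.1, x.1 * y.2 + x.2 * y.1))
    (hd : ∀ x, e (F x) = F (d x.1, d x.2)) (Φ : Aˣ) (φ : A) (U : Bˣ) (hU : (U : B) = F (Φ, φ))
    (hU' : ((U⁻¹ : Bˣ) : B) = F ((Φ⁻¹ : Aˣ), -((Φ⁻¹ : Aˣ) * (Φ⁻¹ : Aˣ) * φ))) (L X : PDO d) :
    conj U (extOp F L X : PDO e) = extOp F (conj Φ L) (conj Φ X +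
      PDO.comm (darbouxVar d Φ φ * ((darboux d Φ)⁻¹ : (PDO d)ˣ) : PDO d) (conj Φ L)) := by
  have hT : (darboux e U : PDO e) = extOp F (darboux d Φ : PDO d) (darbouxVar d Φ φ) := by
    rw [val_darboux, hU, hU', ← extOp_C (d := d), ← extOp_C (d := d), val_D,
      ← extOp_powD (d := d) h1, extOp_mul hmul hd, extOp_mul hmul hd, val_darboux, darbouxVar, val_D,
      map_neg]
    congr 1
    noncomm_ring
  have hT' : (((darboux e U)⁻¹ : (PDO e)ˣ) : PDO e) =
      extOp F (((darboux d Φ)⁻¹ : (PDO d)ˣ) : PDO d)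
        (-(((darboux d Φ)⁻¹ : (PDO d)ˣ) * darbouxVar d Φ φ * ((darboux d Φ)⁻¹ : (PDO d)ˣ))) := by
    refine Units.inv_eq_of_mul_eq_one_right ?_
    rw [hT, extOp_mul hmul hd, Units.mul_inv, ← mul_neg_one, mul_assoc, mul_assoc,
      Units.mul_inv_cancel_left, mul_neg_one, mul_neg, neg_add_cancel]
    exact extOp_powD h1 0
  rw [conj, hT, hT', extOp_mul hmul hd, extOp_mul hmul hd, PDO.comm, conj, conj]
  congr 1
  simp only [mul_assoc, _root_.add_mul, mul_neg, Units.inv_mul_cancel_left]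
  abel

end Extension

/-- The variation of `L' = T L T⁻¹`. -/
theorem conjVariation_eq (Φ : Aˣ) (L : PDO d) (φ : A) (X : PDO d) : conjVariation Φ L φ X =
    conj Φ X +
      PDO.comm (darbouxVar d Φ φ * ((darboux d Φ)⁻¹ : (PDO d)ˣ) : PDO d) (conj Φ L) := by
  let F : A × A →+ DualNumber A :=
    { toFun := fun x => dual x.1 x.2
      map_zero' := by ext <;> simp
      map_add' := fun x y => by ext <;> simp }
  have h := conj_extOp (d := d) (e := dualDer d) (F := F) (by ext <;> simp [F])
    (fun x y => by ext <;> simp [F]) (fun x => TrivSqZeroExt.ext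
      ((fst_dual _ _).trans ((congrArg d (fst_dual _ _)).trans (fst_dual _ _).symm))
      ((snd_dual _ _).trans ((congrArg d (snd_dual _ _)).trans (snd_dual _ _).symm))) Φ φ (dualUnit Φ φ) rfl
    rfl L X
  ext i
  exact (congrArg (fun P => (coeff P i).snd) h).trans (snd_dual _ _)

end CKP

/-! ### Constants of the derivation and infinite sums of operators -/

namespace PDO

variable {A : Type*} [CommRing A] {d : Derivation ℤ A A}

theorem C_mul_comm {a : A} (ha : d a = 0) (P : PDO d) : C d a * P = P * C d a := by
  ext n
  rw [coeff_C_mul, coeff_mul, finsum_eq_single _ (n, 0)]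
  · simp [coeff_C, mul_comm]
  · rintro ⟨i, m⟩ h
    by_cases hm : m = 0
    · subst hm
      have hi : n - i + ((0 : ℕ) : ℤ) ≠ 0 := fun hi => h (by rw [show i = n by omega])
      rw [coeff_C, if_neg hi, iterate_map_zero, mul_zero, smul_zero]
    · obtain ⟨m, rfl⟩ := Nat.exists_eq_succ_of_ne_zero hm
      rw [coeff_C, Function.iterate_succ_apply]
      split_ifs <;> simp [ha, iterate_map_zero]

theorem posApply_C_mul (a : A) (P : PDO d) (f : A) :
    (C d a * P).posApply f = a * P.posApply f := by
  rw [posApply_eq_coeff, pos_C_mul, mul_assoc, coeff_C_mul, ← posApply_eq_coeff]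

theorem comm_add_left (P Q L : PDO d) : (P + Q).comm L = P.comm L + Q.comm L := by
  simp only [PDO.comm, _root_.add_mul, _root_.mul_add]
  abel

theorem comm_neg_left (P L : PDO d) : (-P).comm L = -P.comm L := by
  simp only [PDO.comm, neg_mul, mul_neg]
  abel

/-! ### Coefficientwise sums of operators of bounded order -/

variable [TopologicalSpace A] {ι : Type*}

/-- `S` is the coefficientwise sum of the operators `N l`, whose orders are bounded. -/
def HasCoeffSum (N : ι → PDO d) (S : PDO d) : Prop :=
  (∃ B : ℤ, ∀ l i, B < i → (N l).coeff i = 0) ∧ ∀ n, HasSum (fun l => (N l).coeff n) (S.coeff n)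

theorem hasSum_iterate (hd : Continuous d) {f : ι → A} {a : A} (hf : HasSum f a) (m : ℕ) :
    HasSum (fun l => d^[m] (f l)) (d^[m] a) := by
  induction m with
  | zero => exact hf
  | succ m ih =>
    simp only [Function.iterate_succ_apply']
    exact ih.map d hd

theorem hasCoeffSum_C {f : ι → A} {a : A} (hf : HasSum f a) :
    HasCoeffSum (fun l => C d (f l)) (C d a) := by
  refine ⟨⟨0, fun l i hi => if_neg hi.ne'⟩, fun n => ?_⟩
  simp only [coeff_C]
  split_ifs
  · exact hf
  · exact hasSum_zero

variable [IsTopologicalRing A] {N N' : ι → PDO d} {S S' : PDO d}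

theorem HasCoeffSum.add (h : HasCoeffSum N S) (h' : HasCoeffSum N' S') :
    HasCoeffSum (fun l => N l + N' l) (S + S') := by
  obtain ⟨⟨B, hB⟩, h⟩ := h
  obtain ⟨⟨B', hB'⟩, h'⟩ := h'
  refine ⟨⟨max B B', fun l i hi => ?_⟩, fun n => (h n).add (h' n)⟩
  rw [coeff_add, hB l i (lt_of_le_of_lt (le_max_left _ _) hi),
    hB' l i (lt_of_le_of_lt (le_max_right _ _) hi), add_zero]

/-- The common bound on the orders makes each coefficient of P·N l a finite sum over an index set
independent of l; continuity of d then lets the infinite sum pass through. -/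
theorem HasCoeffSum.mul_left (hd : Continuous d) (h : HasCoeffSum N S) (P : PDO d) :
    HasCoeffSum (fun l => P * N l) (P * S) := by
  obtain ⟨⟨B, hB⟩, h⟩ := h
  obtain ⟨K, hBK, hS⟩ := S.exists_bound B
  have hN : ∀ l i, K < i → (N l).coeff i = 0 := fun l i hi => hB l i (by omega)
  obtain ⟨R, hR⟩ := P.bdd
  refine ⟨⟨R + K, fun l => bound_mul hR (hN l)⟩, fun n => ?_⟩
  obtain ⟨M, hnM, hM⟩ := P.exists_bound (n - K)
  obtain ⟨k, rfl⟩ : ∃ k : ℕ, n = M + K - k := ⟨(M + K - n).toNat, by omega⟩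
  rw [coeff_mul_eq P S M K hM hS]
  simp only [fun l => coeff_mul_eq P (N l) M K hM (hN l)]
  refine hasSum_sum fun p _ => hasSum_sum fun q _ => ?_
  simp only [zsmul_eq_mul]
  exact ((hasSum_iterate hd (h _) _).mul_left _).mul_left _

theorem HasCoeffSum.mul_right (h : HasCoeffSum N S) (P : PDO d) :
    HasCoeffSum (fun l => N l * P) (S * P) := by
  obtain ⟨⟨B, hB⟩, h⟩ := h
  obtain ⟨K₀, hBK, hS⟩ := S.exists_bound B
  obtain ⟨R, hR⟩ := P.bdd
  refine ⟨⟨B + R, fun l => bound_mul (hB l) hR⟩, fun n => ?_⟩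
  obtain ⟨K, hK, hn⟩ : ∃ K, K₀ ≤ K ∧ n - R ≤ K := ⟨max K₀ (n - R), le_max_left _ _, le_max_right _ _⟩
  obtain ⟨k, rfl⟩ : ∃ k : ℕ, n = K + R - k := ⟨(K + R - n).toNat, by omega⟩
  rw [coeff_mul_eq S P K R (fun i hi => hS i (by omega)) hR]
  simp only [fun l => coeff_mul_eq (N l) P K R (fun i hi => hB l i (by omega)) hR]
  refine hasSum_sum fun p _ => hasSum_sum fun q _ => ?_
  simp only [zsmul_eq_mul]
  exact ((h _).mul_right _).mul_left _

end PDO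

namespace CKP

open PDO

variable {A : Type*} [CommRing A] {d : Derivation ℤ A A}

theorem posApply_sum_right {ι : Type*} (P : PDO d) (s : Finset ι) (f : ι → A) :
    P.posApply (∑ j ∈ s, f j) = ∑ j ∈ s, P.posApply (f j) := by
  simp only [posApply_eq_coeff, map_sum, Finset.mul_sum, coeff_sum]

/-! ### Convergence of the series in M and their negative parts -/

section Sums

variable [TopologicalSpace A]

theorem hasCoeffSum_negSum {N : ℕ+ → PDO d} (h : ∀ n, Summable fun l => (N l).coeff n) :
    HasCoeffSum (fun l => (N l).neg) (negSum N) := by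
  refine ⟨⟨-1, fun l i hi => if_neg (by omega)⟩, fun n => ?_⟩
  simp only [coeff_neg_part, negSum]
  split_ifs
  · exact (h n).hasSum
  · exact hasSum_zero

theorem negSum_eq [T2Space A] {N : ℕ+ → PDO d} {S : PDO d}
    (h : HasCoeffSum (fun l => (N l).neg) S) : negSum N = S := by
  ext n
  have hn := h.2 n
  simp only [coeff_neg_part] at hn
  simp only [negSum]
  split_ifs with hi
  · simp only [if_pos hi] at hn
    exact hn.tsum_eq
  · simp only [if_neg hi] at hn
    exact hasSum_zero.unique hn

variable [IsTopologicalRing A]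

/-- The pseudo-differential part of the conjugate of a sum of operators. -/
theorem negSum_conj [T2Space A] (hd : Continuous d) (Φ : Aˣ) {N : ℕ+ → PDO d}
    (h : ∀ n, Summable fun l => (N l).coeff n) (hΦ : Summable fun l => (N l).posApply (Φ : A)) :
    negSum (fun l => conj Φ (N l)) = conj Φ (negSum N) +
      C d ((darboux d Φ : PDO d).posApply (posSumApply N (Φ : A))) * ((D d)⁻¹ : (PDO d)ˣ) *
        C d (Φ⁻¹ : Aˣ) := by
  refine negSum_eq ?_
  -- The orders of the N l may be unbounded, so `neg_conj` is applied to each summand first: the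
  -- negative parts and the functions (N l)₊(Φ) are families of bounded order.
  simp only [neg_conj, posApply_darboux]
  exact (((hasCoeffSum_negSum h).mul_left hd _).mul_right _).add
    (((hasCoeffSum_C (((hΦ.hasSum.mul_left _).map d hd).mul_left _)).mul_right _).mul_right _)

/-- For l ≠ 1 the coordinate tₗ is constant in x and factors out to the left of the summands of M.
The exception t₁ = x affects a single term. -/
theorem summable_of_eq_mul {dt : ℕ+ → Derivation ℤ A A} {t : ℕ+ → A} (htime : IsTimeSystem dt t)
    {f a : ℕ+ → A} (h : ∀ l, l ≠ 1 → f l = t l * a l) : Summable f :=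
  (htime.summable a).congr_cofinite
    ((Set.finite_singleton (1 : ℕ+)).subset fun l hl => by
      by_contra hc
      exact hl (h l hc).symm)

end Sums

/-! ### The terms Yₖ under conjugation by T -/

section Algebra

variable [Algebra ℚ A]

theorem M_mul_eq {t : ℕ+ → A} {l : ℕ+} (ht : d (t l) = 0) (r : ℕ) (W : (PDO d)ˣ) (P : PDO d) :
    M t r W l * P = C d (t l) * (W * C d (algebraMap ℚ A ((l : ℚ) / r)) *
      ((D d ^ ((l : ℤ) - r) : (PDO d)ˣ) : PDO d) * (W⁻¹ : (PDO d)ˣ) * P) := by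
  rw [M, mul_comm (algebraMap ℚ A _), map_mul, ← mul_assoc (W : PDO d), ← C_mul_comm ht]
  simp only [mul_assoc]

theorem deriv_algebraMap (q : ℚ) : d (algebraMap ℚ A q) = 0 := by
  rw [Algebra.algebraMap_eq_smul_one, map_rat_smul, d.map_one_eq_zero, smul_zero]

theorem posApply_darboux_algebraMap_mul (Φ : Aˣ) (q : ℚ) (f : A) :
    (darboux d Φ : PDO d).posApply (algebraMap ℚ A q * f) =
      algebraMap ℚ A q * (darboux d Φ : PDO d).posApply f := by
  rw [mul_comm, posApply_darboux_mul, deriv_algebraMap, mul_zero, zero_add, mul_comm]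

variable {Φ : Aˣ} {Ψ : A} {L : PDO d}

theorem conj_Y (p : NonlocalAction L Φ Ψ) (k : ℕ) :
    conj Φ (Y p k) =
      C d ((darboux d Φ : PDO d).posApply (applyY p k)) * ((D d)⁻¹ : (PDO d)ˣ) * C d (Φ⁻¹ : Aˣ) +
      ∑ j ∈ Finset.range (k - 1), C d (coeffY A k j) *
        (C d ((darboux d Φ : PDO d).posApply (p.φ (k - 2 - j))) * ((D d)⁻¹ : (PDO d)ˣ) *
          C d (darbouxψ p (j + 1))) := by
  rw [Y, conj_sum, applyY, posApply_sum_right, map_sum, Finset.sum_mul, Finset.sum_mul,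
    ← Finset.sum_add_distrib]
  refine Finset.sum_congr rfl fun j _ => ?_
  rw [conj_rank_one Φ _ _ (p.S 0 j) (by rw [p.deriv_S, p.φ_zero]), coeffY,
    posApply_darboux_algebraMap_mul _ _ (p.φ _), map_mul (C d) (algebraMap ℚ A _), darbouxψ]
  simp only [mul_assoc]

theorem coeffY_succ_eq (m j : ℕ) : coeffY A (m + 1) j = coeffY A (m + 1) (j + 1) - 1 := by
  rw [coeffY, coeffY, ← map_one (algebraMap ℚ A), ← map_sub]
  congr 1
  push_cast
  ring

/-- The identity for the ghost-symmetry parts of the flow. -/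
theorem conj_Y_sub (hL : L.neg = C d Φ * ((D d)⁻¹ : (PDO d)ˣ) * C d Ψ)
    (p : NonlocalAction L Φ Ψ) {Φ' : A} (p' : NonlocalAction (conj Φ L) Φ' ((Φ⁻¹ : Aˣ) : A))
    (hΦ' : Φ' = (darboux d Φ : PDO d).posApply (p.φ 1))
    (hS : ∀ i, p'.S i 0 = (Φ⁻¹ : Aˣ) * p.φ (i + 1)) (k : ℕ) :
    conj Φ (Y p k) - C d ((darboux d Φ : PDO d).posApply
        (algebraMap ℚ A (k / 2) * p.φ (k - 1) + applyY p k)) * ((D d)⁻¹ : (PDO d)ˣ) *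
          C d (Φ⁻¹ : Aˣ) = Y p' k - (conj Φ L ^ (k - 1)).neg := by
  subst hΦ'
  obtain ⟨hφ, hψ, -⟩ := p'.eq_of_S_eq (NonlocalAction.darboux hL p) hS
  have hφ' : ∀ i, p'.φ i = (darboux d Φ : PDO d).posApply (p.φ (i + 1)) := fun i =>
    congrFun hφ i
  have hψ' : ∀ j, p'.ψ j = darbouxψ p j := fun j => congrFun hψ j
  rw [(neg_pow_and_posApply_pow (neg_conj_lax hL p) p' (k - 1)).1, conj_Y, posApply_add_right,
    posApply_darboux_algebraMap_mul, Y]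
  -- For k = 0 the truncated index k - 1 is 0, but the factor k/2 kills that term and all sums are
  -- empty.
  rcases k with _ | m
  · simp
  -- For j < m = k - 1 this is L̃^{m-1-j}(Φ̃) D⁻¹ (L̃*)ʲ(Ψ̃), the common building block of Ỹₖ and
  -- (L̃^{k-1})₋. For j = m it vanishes because T(Φ) = 0.
  set G : ℕ → PDO d := fun j => C d ((darboux d Φ : PDO d).posApply (p.φ (m - j))) *
    ((D d)⁻¹ : (PDO d)ˣ) * C d (darbouxψ p j) with hG
  have hm : G m = 0 := by
    rw [hG]
    simp only [tsub_self, p.φ_zero, posApply_darboux_self, map_zero, zero_mul]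
  have e1 : ∀ j ∈ Finset.range (m + 1 - 1), C d (coeffY A (m + 1) j) *
      (C d ((darboux d Φ : PDO d).posApply (p.φ (m + 1 - 2 - j))) * ((D d)⁻¹ : (PDO d)ˣ) *
        C d (darbouxψ p (j + 1))) = (C d (coeffY A (m + 1) (j + 1)) - 1) * G (j + 1) := by
    intro j _
    rw [coeffY_succ_eq, map_sub, map_one, show m + 1 - 2 - j = m - (j + 1) by omega]
  have e2 : ∀ j ∈ Finset.range (m + 1 - 1), C d (coeffY A (m + 1) j * p'.φ (m + 1 - 2 - j)) *
      ((D d)⁻¹ : (PDO d)ˣ) * C d (p'.ψ j) = C d (coeffY A (m + 1) j) * G j := by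
    intro j hj
    rw [Finset.mem_range] at hj
    rw [hφ', hψ', map_mul, show m + 1 - 2 - j + 1 = m - j by omega]
    simp only [hG, mul_assoc]
  have e3 : ∀ j ∈ Finset.range (m + 1 - 1), C d (p'.φ (m + 1 - 1 - 1 - j)) *
      ((D d)⁻¹ : (PDO d)ˣ) * C d (p'.ψ j) = G j := by
    intro j hj
    rw [Finset.mem_range] at hj
    rw [hφ', hψ', show m + 1 - 1 - 1 - j + 1 = m - j by omega]
  have e4 : C d (algebraMap ℚ A ((m + 1 : ℕ) / 2) * (darboux d Φ : PDO d).posApply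
      (p.φ (m + 1 - 1))) * ((D d)⁻¹ : (PDO d)ˣ) * C d (Φ⁻¹ : Aˣ) =
      -((C d (coeffY A (m + 1) 0) - 1) * G 0) := by
    -- The coefficient k/2 in the flow of Φ is chosen so that its term is the missing j = 0 term of
    -- the shifted sum: (0 - (k-2)/2) - 1 = -k/2.
    have hc : algebraMap ℚ A ((m + 1 : ℕ) / 2) = -(coeffY A (m + 1) 0 - 1) := by
      rw [coeffY, ← map_one (algebraMap ℚ A), ← map_sub, ← map_neg]
      congr 1
      push_cast
      ring
    rw [hc, map_mul, map_neg, map_sub, map_one]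
    simp only [hG, darbouxψ, mul_assoc, neg_mul]
    rfl
  rw [map_add, _root_.add_mul, _root_.add_mul, e4, Finset.sum_congr rfl e1,
    Finset.sum_congr rfl e2, Finset.sum_congr rfl e3, ← Finset.sum_sub_distrib]
  -- One sum over 0 ≤ j ≤ m is split at both ends: without j = 0 it is the shifted sum, and without
  -- j = m, where G vanishes, it is Ỹₖ - (L̃^{k-1})₋.
  have e5 := Finset.sum_range_succ (fun j => (C d (coeffY A (m + 1) j) - 1) * G j) m
  rw [Finset.sum_range_succ', hm, mul_zero, add_zero] at e5
  simp only [sub_mul, one_mul] at e5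
  simp only [sub_mul, one_mul, add_tsub_cancel_right]
  rw [← e5]
  abel

end Algebra

/-- Lⁿ commutes with L, so [(Lⁿ)₊, L] = -[(Lⁿ)₋, L]. For n = 0 both sides vanish, in accordance with
the convention for t₀. -/
theorem timeDeriv_conj {dt : ℕ+ → Derivation ℤ A A}
    (hcomm : ∀ l m a, dt l (dt m a) = dt m (dt l a)) {r : ℕ} (hr : 0 < r) {W : (PDO (dt 1))ˣ}
    {Φ Ψ : A} (hW : IsCKP dt r W Φ Ψ) (n : ℕ) :
    timeDeriv dt (r * n) (dressed W r) =
      -PDO.comm (dressed W r ^ n).neg (dressed W r) := by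
  rw [timeDeriv]
  split_ifs with h
  · have hc : dressed W r ^ n * dressed W r = dressed W r * dressed W r ^ n := by
      rw [← pow_succ, pow_succ']
    rw [mapCoeff_dressed (hcomm _ 1) W _ r (hW.sato ⟨r * n, h⟩), PNat.mk_coe, ← dressed_pow,
      eq_sub_of_add_eq (pos_add_neg (dressed W r ^ n)), PDO.comm, PDO.comm, sub_mul, mul_sub, hc]
    abel
  · obtain rfl : n = 0 := by
      by_contra hn
      exact h (Nat.mul_pos hr (Nat.pos_of_ne_zero hn))
    rw [pow_zero, ← map_one (C (dt 1)), (isDiff_C _).neg_eq, PDO.comm, zero_mul, mul_zero, sub_zero,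
      neg_zero]

end CKP

/-! ### The induced flow of the transformed Lax operator -/

theorem proposition3 {A : Type*} [CommRing A] [Algebra ℚ A]
    [TopologicalSpace A] [IsTopologicalRing A] [T2Space A]
    (dt : ℕ+ → Derivation ℤ A A) (t : ℕ+ → A) (htime : CKP.IsTimeSystem dt t)
    (r : ℕ) (hr : 0 < r) (W : (PDO (dt 1))ˣ) (Φ : Aˣ) (Ψ : A)
    (hW : CKP.IsCKP dt r W Φ Ψ)
    (L : PDO (dt 1)) (hL : L = CKP.dressed W r)
    (p : CKP.NonlocalAction L Φ Ψ)
    -- the transformed objects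
    (W' : (PDO (dt 1))ˣ) (hW' : W' = CKP.darboux (dt 1) Φ * W * (PDO.D (dt 1))⁻¹)
    (L' : PDO (dt 1)) (hL' : L' = CKP.conj Φ L)
    (Φ' : A) (hΦ' : Φ' = (CKP.darboux (dt 1) Φ : PDO (dt 1)).posApply (p.φ 1))
    (Ψ' : A) (hΨ' : Ψ' = (Φ⁻¹ : Aˣ))
    (M M' : ℕ+ → PDO (dt 1)) (hM : M = CKP.M t r W) (hM' : M' = fun l => CKP.conj Φ (M l)) :
    -- the form of the hierarchy is preserved
    (L' = CKP.dressed W' r ∧ CKP.IsCKP dt r W' Φ' Ψ') ∧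
    -- the series behind the flows converge
    (∀ k : ℕ, (∀ n, Summable fun l => (M l * L ^ k).coeff n) ∧
      (Summable fun l => (M l * L ^ k).posApply (Φ : A)) ∧
      ∀ n, Summable fun l => (M' l * L' ^ k).coeff n) ∧
    -- the transformed nonlocal functions, with `∂ₓ⁻¹(Ψ' L'ⁱ(Φ')) = Φ⁻¹ Lⁱ⁺¹(Φ)`
    (∃ p' : CKP.NonlocalAction L' Φ' Ψ', ∀ i, p'.S i 0 = (Φ⁻¹ : Aˣ) * p.φ (i + 1)) ∧
    -- the flow of the transformed Lax operator
    ∀ p' : CKP.NonlocalAction L' Φ' Ψ', (∀ i, p'.S i 0 = (Φ⁻¹ : Aˣ) * p.φ (i + 1)) →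
      ∀ k : ℕ,
        CKP.conjVariation Φ L (CKP.flowΦ M p k) (CKP.flowL M p k) =
          -PDO.comm (CKP.negSum (fun l => M' l * L' ^ k) - CKP.Y p' k) L' +
            CKP.timeDeriv dt (r * (k - 1)) L' := by
  subst hL hL' hΨ' hM hM' hΦ' hW'
  have hd : Continuous (dt 1) := htime.continuous 1
  have hneg := hW.constraint
  have hL' : CKP.conj Φ (CKP.dressed W r) =
      CKP.dressed (CKP.darboux (dt 1) Φ * W * (PDO.D (dt 1))⁻¹) r :=
    (CKP.dressed_darboux Φ W r).symm
  have hW' := CKP.isCKP_darboux htime.commute hW p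
  have ht : ∀ l, l ≠ 1 → dt 1 (t l) = 0 := fun l hl => by
    rw [htime.dt_t, if_neg hl.symm]
  have hconj : ∀ (k : ℕ) (l : ℕ+), CKP.conj Φ (CKP.M t r W l) * CKP.conj Φ (CKP.dressed W r) ^ k =
      CKP.conj Φ (CKP.M t r W l * CKP.dressed W r ^ k) := fun k l => by
    rw [CKP.conj_mul, CKP.conj_pow]
  have hsum : ∀ k n, Summable fun l => (CKP.M t r W l * CKP.dressed W r ^ k).coeff n :=
    fun k n => CKP.summable_of_eq_mul htime fun l hl => by
      rw [CKP.M_mul_eq (ht l hl), PDO.coeff_C_mul]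
  have hsumΦ : ∀ k, Summable fun l => (CKP.M t r W l * CKP.dressed W r ^ k).posApply (Φ : A) :=
    fun k => CKP.summable_of_eq_mul htime fun l hl => by
      rw [CKP.M_mul_eq (ht l hl), PDO.posApply_C_mul]
  refine ⟨⟨hL', hW'⟩, fun k => ⟨hsum k, hsumΦ k, fun n => ?_⟩,
    ⟨CKP.NonlocalAction.darboux hneg p, fun i => rfl⟩, fun p' hp' k => ?_⟩
  · simp only [hconj]
    exact CKP.summable_of_eq_mul htime fun l hl => by
      rw [CKP.M_mul_eq (ht l hl), CKP.conj, ← mul_assoc, ← PDO.C_mul_comm (ht l hl),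
        mul_assoc, mul_assoc, PDO.coeff_C_mul]
  · have hY := CKP.conj_Y_sub hneg p p' rfl hp' k
    have hT : CKP.timeDeriv dt (r * (k - 1)) (CKP.conj Φ (CKP.dressed W r)) =
        -PDO.comm (CKP.conj Φ (CKP.dressed W r) ^ (k - 1)).neg (CKP.conj Φ (CKP.dressed W r)) := by
      rw [hL']
      exact CKP.timeDeriv_conj htime.commute hr hW' (k - 1)
    simp only [hconj]
    -- Both sides are collected into a single commutator with L̃. The terms in (MLᵏ)₊(Φ) agree, and
    -- the equality of the generators reduces to `hY`.
    rw [hT, CKP.negSum_conj hd Φ (hsum k) (hsumΦ k), CKP.conjVariation_eq, CKP.flowL, PDO.comm,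
      CKP.conj_sub, CKP.conj_mul, CKP.conj_mul, ← PDO.comm, ← PDO.comm_add_left,
      ← PDO.comm_neg_left, ← PDO.comm_neg_left, ← PDO.comm_add_left, CKP.darbouxVar_mul_inv,
      CKP.conj_add, CKP.conj_neg, CKP.flowΦ, add_assoc (CKP.posSumApply _ _),
      PDO.posApply_add_right, map_add, add_mul, add_mul, neg_sub, sub_add_eq_sub_sub]
    congr 1
    rw [← sub_eq_zero] at hY ⊢
    rw [← hY]
    abel
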